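/- Let $X$ be the exterior of the $(-2,3,7)$-pretzel knot $K\subset S^3$, let $$\pi_1(X)=\langle a,b \mid a^2b^{-1}a^2=b^2ab^2\rangle$$ be its knot group (isomorphic to the Wirtinger group of the standard diagram of $K$, with $\mu=a^{-1}b^2$ a meridian and $\mu^{-19}\sigma$, $\sigma=ab^{-1}a^2b^{-1}a^2$, the corresponding homological longitude), and let $P=\pi_1(\partial X)\subset\pi_1(X)$ be the peripheral subgroup generated by $\mu$ and this longitude. For $z\in\mathbb{C}$ with $|z|=1$ let $\rho^{\mathrm{ab}}_z:\pi_1(X)\to \mathrm{SU}(1,1)$ be the reducible representation that factors through $H_1(X;\mathbb{Z})\cong\mathbb{Z}$ and sends the class of $\mu$ to $\mathrm{diag}(z,z^{-1})$. A representation $\rho:\pi_1(X)\to\mathrm{SU}(1,1)$ is called elliptic if $\rho(P)\not\subset\{\pm1\}$ and every element of $\rho(P)$ other than $\pm 1$ is elliptic (i.e. $|\mathrm{tr}|<2$), and irreducible if no line in $\mathbb{C}^2$ is invariant under it. Theorem. There are real numbers $\theta_0,t_0,t_1$ such that * $|\theta_0-2.0453|\le 0.00005$ and $e^{i\theta_0}$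 is a root of the Alexander polynomial of $K$; * $t_0=2\cos(5\theta_0/2)$, $0<t_0<t_1<1$ and $\dfrac{t_1^3}{(t_1^2-1)^2}-\dfrac1{t_1}-t_1=2$; and a path of representations $\rho(t):\pi_1(X)\to \mathrm{SU}(1,1)$, $t\in[t_0,t_1)$, continuous in the sense that $t\mapsto\rho(t)(g)$ is continuous for each $g\in\pi_1(X)$, such that $\rho(t_0)=\rho_0:=\rho^{\mathrm{ab}}_{e^{i\theta_0/2}}$ and, for all $t\in[t_0,t_1)$, * $\rho(t)$ is elliptic, and $\rho(t)$ is irreducible if and only if $t\ne t_0$; * $\mathrm{tr}\,\rho(t)(a)=t$, $\ \mathrm{tr}\,\rho(t)(b)=s:=\dfrac{t}{t^2-1}$, $\ \mathrm{tr}\,\rho(t)(ab)=r:=1-\dfrac1{t^2}$. Moreover there are continuous functions $\alpha,\beta,R:[t_0,t_1)\to\mathbb{R}$ with $\alpha\in(\tfrac{3\pi}2,2\pi)$, $\beta\in(\tfrac\pi2,\pi)$ and $$\rho(t)(a)=\begin{pmatrix}e^{i\alpha}&0\\0&e^{-i\alpha}\end{pmatrix},\qquad \rho(t)(b)=\begin{pmatrix}\sqrt{1+R^2}\,e^{i\beta}&R\\R&\sqrt{1+R^2}\,e^{-i\beta}\end{pmatrix},$$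 $$\cos\alpha=\frac t2,\qquad \tan\beta=\frac1{\sin\alpha}\Big(\frac t2-\frac rs\Big),\qquad R^2=\Big(\frac{s}{2\cos\beta}\Big)^2-1 .$$ -/

import Mathlib

open scoped Matrix Polynomial

noncomputable section

/-! ### Knot diagrams, knot groups, peripheral subgroups, Alexander polynomials -/

/-- The Gauss data of an oriented knot diagram with `n + 1` crossings.  Walking along the knot, one
meets the arcs `0, 1, …, n` of the diagram in this cyclic order; arc `k` ends by passing under
arc `overArc k`, at a crossing of sign `sign k`, and continues as arc `k + 1` (indices modulo
`n + 1`). -/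
structure KnotDiagram (n : ℕ) where
  overArc : Fin (n + 1) → Fin (n + 1)
  sign : Fin (n + 1) → ℤˣ

namespace KnotDiagram

variable {n : ℕ} (D : KnotDiagram n)

/-- The Wirtinger relator `x (k+1)⁻¹ * (g⁻¹ * x k * g)`, with `g = x (overArc k) ^ sign k`,
at the end of arc `k`. -/
def wirtingerRelator (k : Fin (n + 1)) : FreeGroup (Fin (n + 1)) :=
  (FreeGroup.of (k + 1))⁻¹ *
    ((FreeGroup.of (D.overArc k) ^ (D.sign k : ℤ))⁻¹ * FreeGroup.of k *
      FreeGroup.of (D.overArc k) ^ (D.sign k : ℤ))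

/-- The knot group `π₁(X)` of the exterior `X` of the knot, through its Wirtinger presentation. -/
abbrev KnotGroup : Type :=
  PresentedGroup (Set.range D.wirtingerRelator)

/-- The Wirtinger generator of arc `k`. -/
def arc (k : Fin (n + 1)) : D.KnotGroup := PresentedGroup.of k

/-- The meridian at arc `0`. -/
def meridian : D.KnotGroup := D.arc 0

/-- The homological longitude that commutes with the meridian at arc `0`: read off the generators
of the arcs under which the knot passes, and correct by the writhe. -/
def longitude : D.KnotGroup :=
  (List.ofFn fun k => D.arc (D.overArc k) ^ (D.sign k : ℤ)).prod *
    D.meridian ^ (-∑ k, (D.sign k : ℤ))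

/-- The peripheral subgroup, the image of `π₁(∂X)`. -/
def peripheral : Subgroup D.KnotGroup := Subgroup.closure {D.meridian, D.longitude}

/-- The Alexander matrix: row `k` holds the abelianized Fox derivatives of the Wirtinger relation
at the end of arc `k`, which is `x (overArc k) * x (k+1) = x k * x (overArc k)` at a positive
crossing and `x (k+1) * x (overArc k) = x (overArc k) * x k` at a negative one. -/
def alexanderMatrix : Matrix (Fin (n + 1)) (Fin (n + 1)) ℤ[X] := fun k j =>
  if D.sign k = 1 then
    (if j = k + 1 then Polynomial.X else 0) + (if j = D.overArc k then 1 - Polynomial.X else 0)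
      - (if j = k then 1 else 0)
  else
    (if j = k + 1 then 1 else 0) - (if j = D.overArc k then 1 - Polynomial.X else 0)
      - (if j = k then Polynomial.X else 0)

/-- The Alexander polynomial (well defined up to a factor `± T ^ m`): the determinant of the
Alexander matrix with one row and one column deleted. -/
def alexanderPolynomial : ℤ[X] :=
  (D.alexanderMatrix.submatrix Fin.succ Fin.succ).det

end KnotDiagram

/-! ### The group SU(1,1) and representations into it -/

/-- The Gram matrix of the Hermitian form of signature `(1,1)` on `ℂ²`. -/
def gramOneOne : Matrix (Fin 2) (Fin 2) ℂ := !![1, 0; 0, -1]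

/-- `SU(1,1)`: the complex `2 × 2` matrices of determinant one that preserve the Hermitian form
`|z|² - |w|²`.  It has the subspace topology. -/
def SU11 : Subgroup (Matrix.SpecialLinearGroup (Fin 2) ℂ) where
  carrier := {A | (A : Matrix (Fin 2) (Fin 2) ℂ)ᴴ * gramOneOne * (A : Matrix (Fin 2) (Fin 2) ℂ)
    = gramOneOne}
  one_mem' := by simp
  mul_mem' := by
    intro A B hA hB
    simp only [Set.mem_ofPred_eq, Matrix.SpecialLinearGroup.coe_mul,
      Matrix.conjTranspose_mul] at *
    calc _ = (B : Matrix (Fin 2) (Fin 2) ℂ)ᴴ * ((A : Matrix (Fin 2) (Fin 2) ℂ)ᴴ * gramOneOne *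
          (A : Matrix (Fin 2) (Fin 2) ℂ)) * (B : Matrix (Fin 2) (Fin 2) ℂ) := by
            simp only [Matrix.mul_assoc]
      _ = _ := by rw [hA, hB]
  inv_mem' := by
    intro A hA
    simp only [Set.mem_ofPred_eq] at *
    have h : (A : Matrix (Fin 2) (Fin 2) ℂ) * (A⁻¹ : Matrix.SpecialLinearGroup (Fin 2) ℂ) = 1 := by
      rw [← Matrix.SpecialLinearGroup.coe_mul, mul_inv_cancel, Matrix.SpecialLinearGroup.coe_one]
    have h2 : ((A⁻¹ : Matrix.SpecialLinearGroup (Fin 2) ℂ) : Matrix (Fin 2) (Fin 2) ℂ)ᴴ *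
        (A : Matrix (Fin 2) (Fin 2) ℂ)ᴴ = 1 := by
      rw [← Matrix.conjTranspose_mul, h, Matrix.conjTranspose_one]
    generalize ((A⁻¹ : Matrix.SpecialLinearGroup (Fin 2) ℂ) : Matrix (Fin 2) (Fin 2) ℂ) = B at *
    calc Bᴴ * gramOneOne * B
        = Bᴴ * ((A : Matrix (Fin 2) (Fin 2) ℂ)ᴴ * gramOneOne *
          (A : Matrix (Fin 2) (Fin 2) ℂ)) * B := by rw [hA]
      _ = (Bᴴ * (A : Matrix (Fin 2) (Fin 2) ℂ)ᴴ) * gramOneOne *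
          ((A : Matrix (Fin 2) (Fin 2) ℂ) * B) := by simp only [Matrix.mul_assoc]
      _ = gramOneOne := by rw [h, h2, Matrix.one_mul, Matrix.mul_one]

namespace SU11

/-- The underlying complex matrix. -/
def toMatrix (A : SU11) : Matrix (Fin 2) (Fin 2) ℂ := (A : Matrix.SpecialLinearGroup (Fin 2) ℂ)

/-- The trace (a real number, regarded as a complex one). -/
def tr (A : SU11) : ℂ := (SU11.toMatrix A).trace

/-- The diagonal matrix with entries `z` and `z⁻¹`, for `z` on the unit circle. -/
def diag (z : Circle) : SU11 :=
  ⟨⟨!![(z : ℂ), 0; 0, (z⁻¹ : Circle)], by simp [Matrix.det_fin_two_of]⟩, by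
    have h1 : (starRingEnd ℂ) (z : ℂ) * (z : ℂ) = 1 := by
      rw [← Circle.coe_inv_eq_conj, ← Circle.coe_mul]; simp
    change (!![(z : ℂ), 0; 0, (z⁻¹ : Circle)])ᴴ * gramOneOne * !![(z : ℂ), 0; 0, (z⁻¹ : Circle)]
      = gramOneOne
    ext i j
    fin_cases i <;> fin_cases j <;>
      simp [gramOneOne, Matrix.mul_apply, Fin.sum_univ_two, h1, ← mul_inv]⟩

/-- `A` acts on the hyperbolic plane as an elliptic isometry. -/
def IsElliptic (A : SU11) : Prop := ‖SU11.tr A‖ < 2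

/-- `A` is trivial in `PSU(1,1)`, i.e. acts trivially on the hyperbolic plane. -/
def IsCentral (A : SU11) : Prop := SU11.toMatrix A = 1 ∨ SU11.toMatrix A = -1

end SU11

/-- The representation on `ℂ²` that a homomorphism to `SU(1,1)` defines. -/
def SU11.linearRep {G : Type*} [Group G] (ρ : G →* SU11) : Representation ℂ G (Fin 2 → ℂ) where
  toFun g := Matrix.toLin' (SU11.toMatrix (ρ g))
  map_one' := by simp [SU11.toMatrix, Module.End.one_eq_id]
  map_mul' g h := by simp [SU11.toMatrix, Matrix.toLin'_mul, Module.End.mul_eq_comp]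

/-- `ρ` is irreducible: `ℂ²` has no invariant line. -/
def SU11.IsIrreducibleRep {G : Type*} [Group G] (ρ : G →* SU11) : Prop :=
  (SU11.linearRep ρ).IsIrreducible

namespace KnotDiagram

variable {n : ℕ} (D : KnotDiagram n)

/-- `ρ` is elliptic: its restriction to the peripheral subgroup has nontrivial image in
`PSU(1,1)`, and all nontrivial elements of that image are elliptic. -/
def IsEllipticRep (ρ : D.KnotGroup →* SU11) : Prop :=
  (∃ g ∈ D.peripheral, ¬ SU11.IsCentral (ρ g)) ∧
    ∀ g ∈ D.peripheral, SU11.IsCentral (ρ g) ∨ SU11.IsElliptic (ρ g)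

/-- The reducible representation that factors through the abelianization `ℤ` of the knot group and
sends (the class of) the meridian to the diagonal matrix with entries `z` and `z⁻¹`. -/
def abelianRep (z : Circle) : D.KnotGroup →* SU11 :=
  PresentedGroup.toGroup (f := fun _ => SU11.diag z) (by
    rintro _ ⟨k, rfl⟩
    simp only [wirtingerRelator, map_mul, map_inv, map_zpow, FreeGroup.lift_apply_of]
    group)

end KnotDiagram

/-! ### The pretzel knot P(-2,3,7) -/

/-- The standard diagram of the pretzel knot `P(-2,3,7)`: three vertical columns of 2, 3 and 7
crossings, with the column of 2 twisted in the opposite sense to the other two.  Call the crossings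
`a1, a2`, `b1, b2, b3` and `c1, …, c7`, from top to bottom in the three columns from left to right.
Walking along the knot one meets, with `+` for passing over and `-` for passing under,
`a1+ a2- c7- c6+ c5- c4+ c3- c2+ c1- b1+ b2- b3+ a2+ a1- b1- b2+ b3- c7+ c6- c5+ c4- c3+ c2- c1+`
(and back to `a1+`), and all crossings are positive.  Arc `0` ends at `a2`, arcs `1, …, 11` end
at `c7, c5, c3, c1, b2, a1, b1, b3, c6, c4, c2`. -/
def pretzel : KnotDiagram 11 where
  overArc := ![6, 9, 10, 11, 0, 8, 0, 5, 6, 2, 3, 4]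
  sign := fun _ => 1

/-- The relator of `⟨a, b | a² b⁻¹ a² = b² a b²⟩`, with `a, b` the generators `0, 1`. -/
def pretzelRelator : FreeGroup (Fin 2) :=
  let a := FreeGroup.of (0 : Fin 2)
  let b := FreeGroup.of (1 : Fin 2)
  a ^ 2 * b⁻¹ * a ^ 2 * (b ^ 2 * a * b ^ 2)⁻¹

/-- The two-generator presentation of the group of `P(-2,3,7)`. -/
abbrev PretzelPresentation : Type := PresentedGroup ({pretzelRelator} : Set (FreeGroup (Fin 2)))

theorem pretzelPresentation_relation {a b : PretzelPresentation}
    (ha : a = PresentedGroup.of 0) (hb : b = PresentedGroup.of 1) :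
    a ^ 2 * b⁻¹ * a ^ 2 = b ^ 2 * a * b ^ 2 := by
  subst ha hb
  have h : (PresentedGroup.mk ({pretzelRelator} : Set (FreeGroup (Fin 2)))) pretzelRelator = 1 :=
    PresentedGroup.one_of_mem rfl
  rw [← mul_inv_eq_one]
  exact h

theorem pretzel_wirtinger (k : Fin 12) :
    pretzel.arc (k + 1) =
      (pretzel.arc (pretzel.overArc k))⁻¹ * pretzel.arc k * pretzel.arc (pretzel.overArc k) := by
  have h : (PresentedGroup.mk (Set.range pretzel.wirtingerRelator))
      (pretzel.wirtingerRelator k) = 1 := PresentedGroup.one_of_mem ⟨k, rfl⟩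
  have h2 : pretzel.wirtingerRelator k = (FreeGroup.of (k + 1))⁻¹ *
      ((FreeGroup.of (pretzel.overArc k))⁻¹ * FreeGroup.of k *
        FreeGroup.of (pretzel.overArc k)) := by
    simp [KnotDiagram.wirtingerRelator, pretzel]
  rw [h2, map_mul, map_inv, inv_mul_eq_one] at h
  exact h

/-- The consequences of the twelve Wirtinger relations of `pretzel` on which the isomorphism with
the two-generator presentation rests. -/
theorem pretzel_arc_formulas {c g : pretzel.KnotGroup} (hc : c = pretzel.arc 0 * pretzel.arc 5)
    (hg : g = pretzel.arc 8) :
    pretzel.arc 1 = c ^ 4 * (pretzel.arc 0)⁻¹ * (c ^ 3)⁻¹ ∧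
    pretzel.arc 2 = c ^ 3 * (pretzel.arc 0)⁻¹ * (c ^ 2)⁻¹ ∧
    pretzel.arc 3 = c ^ 2 * (pretzel.arc 0)⁻¹ * c⁻¹ ∧
    pretzel.arc 4 = c * (pretzel.arc 0)⁻¹ ∧
    pretzel.arc 5 = (pretzel.arc 0)⁻¹ * c ∧
    pretzel.arc 6 = c * g * c⁻¹ ∧
    pretzel.arc 7 = (pretzel.arc 0)⁻¹ * (c * g * c⁻¹) * pretzel.arc 0 ∧
    pretzel.arc 9 = c ^ 3 * pretzel.arc 0 * (c ^ 3)⁻¹ ∧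
    pretzel.arc 10 = c ^ 2 * pretzel.arc 0 * (c ^ 2)⁻¹ ∧
    pretzel.arc 11 = c * pretzel.arc 0 * c⁻¹ ∧
    pretzel.arc 0 = (c ^ 2)⁻¹ * g⁻¹ * c⁻¹ * g * c * g * c ^ 2 ∧
    pretzel.arc 0 = c * g * c * g⁻¹ * c⁻¹ * g⁻¹ := by
  have e2 : pretzel.arc 3 = (pretzel.arc 10)⁻¹ * pretzel.arc 2 * pretzel.arc 10 :=
    pretzel_wirtinger 2
  have e1 : pretzel.arc 2 = (pretzel.arc 9)⁻¹ * pretzel.arc 1 * pretzel.arc 9 :=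
    pretzel_wirtinger 1
  have e3 : pretzel.arc 4 = (pretzel.arc 11)⁻¹ * pretzel.arc 3 * pretzel.arc 11 :=
    pretzel_wirtinger 3
  have e4 : pretzel.arc 5 = (pretzel.arc 0)⁻¹ * pretzel.arc 4 * pretzel.arc 0 :=
    pretzel_wirtinger 4
  have e5 : pretzel.arc 6 = (pretzel.arc 8)⁻¹ * pretzel.arc 5 * pretzel.arc 8 :=
    pretzel_wirtinger 5
  have e6 : pretzel.arc 7 = (pretzel.arc 0)⁻¹ * pretzel.arc 6 * pretzel.arc 0 :=
    pretzel_wirtinger 6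
  have e7 : pretzel.arc 8 = (pretzel.arc 5)⁻¹ * pretzel.arc 7 * pretzel.arc 5 :=
    pretzel_wirtinger 7
  have e8 : pretzel.arc 9 = (pretzel.arc 6)⁻¹ * pretzel.arc 8 * pretzel.arc 6 :=
    pretzel_wirtinger 8
  have e9 : pretzel.arc 10 = (pretzel.arc 2)⁻¹ * pretzel.arc 9 * pretzel.arc 2 :=
    pretzel_wirtinger 9
  have e10 : pretzel.arc 11 = (pretzel.arc 3)⁻¹ * pretzel.arc 10 * pretzel.arc 3 :=
    pretzel_wirtinger 10
  have e11 : pretzel.arc 0 = (pretzel.arc 4)⁻¹ * pretzel.arc 11 * pretzel.arc 4 :=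
    pretzel_wirtinger 11
  generalize pretzel.arc 0 = x0, pretzel.arc 1 = x1, pretzel.arc 2 = x2, pretzel.arc 3 = x3,
    pretzel.arc 4 = x4, pretzel.arc 5 = x5, pretzel.arc 6 = x6, pretzel.arc 7 = x7,
    pretzel.arc 8 = x8, pretzel.arc 9 = x9, pretzel.arc 10 = x10, pretzel.arc 11 = x11 at *
  subst hg
  have f5 : x5 = x0⁻¹ * c := by rw [hc]; simp
  have f4 : x4 = c * x0⁻¹ := by
    rw [hc, e4]; simp [mul_assoc]
  have f11 : x11 = c * x0 * c⁻¹ := by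
    have : x11 = x4 * x0 * x4⁻¹ := by rw [e11]; simp [mul_assoc]
    rw [this, f4]; simp [mul_assoc]
  have f3 : x3 = c ^ 2 * x0⁻¹ * c⁻¹ := by
    have : x3 = x11 * x4 * x11⁻¹ := by rw [e3]; simp [mul_assoc]
    rw [this, f4, f11]; simp [pow_succ, mul_assoc]
  have f10 : x10 = c ^ 2 * x0 * (c ^ 2)⁻¹ := by
    have : x10 = x3 * x11 * x3⁻¹ := by rw [e10]; simp [mul_assoc]
    rw [this, f3, f11]; simp [pow_succ, mul_assoc]
  have f2 : x2 = c ^ 3 * x0⁻¹ * (c ^ 2)⁻¹ := by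
    have : x2 = x10 * x3 * x10⁻¹ := by rw [e2]; simp [mul_assoc]
    rw [this, f3, f10]; simp [pow_succ, mul_assoc]
  have f9 : x9 = c ^ 3 * x0 * (c ^ 3)⁻¹ := by
    have : x9 = x2 * x10 * x2⁻¹ := by rw [e9]; simp [mul_assoc]
    rw [this, f2, f10]; simp [pow_succ, mul_assoc]
  have f1 : x1 = c ^ 4 * x0⁻¹ * (c ^ 3)⁻¹ := by
    have : x1 = x9 * x2 * x9⁻¹ := by rw [e1]; simp [mul_assoc]
    rw [this, f2, f9]; simp [pow_succ, mul_assoc]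
  have f6 : x6 = c * g * c⁻¹ := by
    rw [e7, e6, f5]; simp [mul_assoc]
  refine ⟨f1, f2, f3, f4, f5, f6, by rw [e6, f6], f9, f10, f11, ?_, ?_⟩
  · have : x0 = (c ^ 3)⁻¹ * x9 * c ^ 3 := by rw [f9]; simp [mul_assoc]
    rw [this, e8, f6]; simp [pow_succ, mul_assoc]
  · have : x0⁻¹ = g * x6 * g⁻¹ * c⁻¹ := by rw [e5, f5]; simp [mul_assoc]
    rw [← inv_inv x0, this, f6]; simp [mul_assoc]

/-- The isomorphism from the two-generator presentation onto the Wirtinger group. -/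
def pretzelHom : PretzelPresentation →* pretzel.KnotGroup :=
  PresentedGroup.toGroup
    (f := ![pretzel.arc 8 * (pretzel.arc 0 * pretzel.arc 5) ^ 2,
      (pretzel.arc 0 * pretzel.arc 5)⁻¹ * pretzel.arc 8 *
        (pretzel.arc 0 * pretzel.arc 5) ^ 2]) (by
    intro r hr
    rw [Set.mem_singleton_iff] at hr
    subst hr
    obtain ⟨-, -, -, -, -, -, -, -, -, -, h1, h2⟩ := pretzel_arc_formulas rfl rfl
    simp only [pretzelRelator, map_mul, map_pow, map_inv, FreeGroup.lift_apply_of,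
      Matrix.cons_val_zero, Matrix.cons_val_one]
    generalize pretzel.arc 0 * pretzel.arc 5 = c, pretzel.arc 8 = g at *
    rw [mul_inv_eq_one]
    have h : (c ^ 2)⁻¹ * g⁻¹ * c⁻¹ * g * c * g * c ^ 2 = c * g * c * g⁻¹ * c⁻¹ * g⁻¹ := h1 ▸ h2
    calc (g * c ^ 2) ^ 2 * (c⁻¹ * g * c ^ 2)⁻¹ * (g * c ^ 2) ^ 2
        = c⁻¹ * (c * g * c ^ 2) * (c * g * c * g⁻¹ * c⁻¹ * g⁻¹) *
            (g * c * g * c * g * c ^ 2) := by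
          simp [pow_succ, mul_assoc]
      _ = (c⁻¹ * g * c ^ 2) ^ 2 * (g * c ^ 2) * (c⁻¹ * g * c ^ 2) ^ 2 := by
          rw [← h]; simp [pow_succ, mul_assoc])

/-- The inverse of `pretzelHom`. -/
def pretzelInvHom : pretzel.KnotGroup →* PretzelPresentation :=
  let a : PretzelPresentation := PresentedGroup.of 0
  let b : PretzelPresentation := PresentedGroup.of 1
  let c := a * b⁻¹
  let g := a * (c ^ 2)⁻¹
  let m := a⁻¹ * b ^ 2
  PresentedGroup.toGroup
    (f := ![m, c ^ 4 * m⁻¹ * (c ^ 3)⁻¹, c ^ 3 * m⁻¹ * (c ^ 2)⁻¹, c ^ 2 * m⁻¹ * c⁻¹, c * m⁻¹,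
      m⁻¹ * c, c * g * c⁻¹, m⁻¹ * (c * g * c⁻¹) * m, g, c ^ 3 * m * (c ^ 3)⁻¹,
      c ^ 2 * m * (c ^ 2)⁻¹, c * m * c⁻¹]) (by
    rintro _ ⟨k, rfl⟩
    have hr := pretzelPresentation_relation (a := a) (b := b) rfl rfl
    have hb : b = c⁻¹ * g * c ^ 2 := by simp [g, c, pow_succ, mul_assoc]
    have ha : a = g * c ^ 2 := by simp [g]
    have hm : m = a⁻¹ * b ^ 2 := rfl
    clear_value m g c
    rw [ha, hb] at hm hr
    have hm1 : m = (c ^ 2)⁻¹ * g⁻¹ * c⁻¹ * g * c * g * c ^ 2 := by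
      rw [hm]; simp [pow_succ, mul_assoc]
    have hm2 : m = c * g * c * g⁻¹ * c⁻¹ * g⁻¹ := by
      calc m = (g * c ^ 2)⁻¹ * ((c⁻¹ * g * c ^ 2) ^ 2 * (g * c ^ 2) * (c⁻¹ * g * c ^ 2) ^ 2) *
              ((g * c ^ 2) * (c⁻¹ * g * c ^ 2) ^ 2)⁻¹ := by
            rw [hm]; simp [pow_succ, mul_assoc]
        _ = _ := by rw [← hr]; simp [pow_succ, mul_assoc]
    have hm3 : m⁻¹ = (c ^ 2)⁻¹ * g⁻¹ * c⁻¹ * g⁻¹ * c * g * c ^ 2 := by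
      rw [hm1]; simp [pow_succ, mul_assoc]
    simp only [KnotDiagram.wirtingerRelator, map_mul, map_inv, FreeGroup.lift_apply_of,
      pretzel, Units.val_one, zpow_one]
    rw [inv_mul_eq_one]
    clear hm hr ha hb
    fin_cases k
    · change c ^ 4 * m⁻¹ * (c ^ 3)⁻¹ = (c * g * c⁻¹)⁻¹ * m * (c * g * c⁻¹)
      rw [hm3, hm2]; simp [pow_succ, mul_assoc]
    · change c ^ 3 * m⁻¹ * (c ^ 2)⁻¹ =
        (c ^ 3 * m * (c ^ 3)⁻¹)⁻¹ * (c ^ 4 * m⁻¹ * (c ^ 3)⁻¹) * (c ^ 3 * m * (c ^ 3)⁻¹)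
      simp [pow_succ, mul_assoc]
    · change c ^ 2 * m⁻¹ * c⁻¹ =
        (c ^ 2 * m * (c ^ 2)⁻¹)⁻¹ * (c ^ 3 * m⁻¹ * (c ^ 2)⁻¹) * (c ^ 2 * m * (c ^ 2)⁻¹)
      simp [pow_succ, mul_assoc]
    · change c * m⁻¹ = (c * m * c⁻¹)⁻¹ * (c ^ 2 * m⁻¹ * c⁻¹) * (c * m * c⁻¹)
      simp [pow_succ, mul_assoc]
    · change m⁻¹ * c = m⁻¹ * (c * m⁻¹) * m
      simp [mul_assoc]
    · change c * g * c⁻¹ = g⁻¹ * (m⁻¹ * c) * g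
      rw [hm2]; simp [mul_assoc]
    · rfl
    · change g = (m⁻¹ * c)⁻¹ * (m⁻¹ * (c * g * c⁻¹) * m) * (m⁻¹ * c)
      simp [mul_assoc]
    · change c ^ 3 * m * (c ^ 3)⁻¹ = (c * g * c⁻¹)⁻¹ * g * (c * g * c⁻¹)
      rw [hm1]; simp [pow_succ, mul_assoc]
    · change c ^ 2 * m * (c ^ 2)⁻¹ =
        (c ^ 3 * m⁻¹ * (c ^ 2)⁻¹)⁻¹ * (c ^ 3 * m * (c ^ 3)⁻¹) * (c ^ 3 * m⁻¹ * (c ^ 2)⁻¹)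
      simp [pow_succ, mul_assoc]
    · change c * m * c⁻¹ =
        (c ^ 2 * m⁻¹ * c⁻¹)⁻¹ * (c ^ 2 * m * (c ^ 2)⁻¹) * (c ^ 2 * m⁻¹ * c⁻¹)
      simp [pow_succ, mul_assoc]
    · change m = (c * m⁻¹)⁻¹ * (c * m * c⁻¹) * (c * m⁻¹)
      simp [mul_assoc])

theorem pretzelHom_of :
    pretzelHom (PresentedGroup.of 0) = pretzel.arc 8 * (pretzel.arc 0 * pretzel.arc 5) ^ 2 ∧
    pretzelHom (PresentedGroup.of 1) = (pretzel.arc 0 * pretzel.arc 5)⁻¹ * pretzel.arc 8 *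
      (pretzel.arc 0 * pretzel.arc 5) ^ 2 :=
  ⟨PresentedGroup.toGroup.of _, PresentedGroup.toGroup.of _⟩

/-- The isomorphism between the two presentations of the group of `P(-2,3,7)`. -/
def pretzelEquiv : PretzelPresentation ≃* pretzel.KnotGroup :=
  MonoidHom.toMulEquiv pretzelHom pretzelInvHom
    (by
      have h0 : pretzelInvHom (pretzel.arc 0) =
          (PresentedGroup.of 0)⁻¹ * PresentedGroup.of 1 ^ 2 := by
        rw [pretzelInvHom, KnotDiagram.arc, PresentedGroup.toGroup.of]; rfl
      have h5 : pretzelInvHom (pretzel.arc 5) =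
          ((PresentedGroup.of 0)⁻¹ * PresentedGroup.of 1 ^ 2)⁻¹ *
            (PresentedGroup.of 0 * (PresentedGroup.of 1)⁻¹) := by
        rw [pretzelInvHom, KnotDiagram.arc, PresentedGroup.toGroup.of]; rfl
      have h8 : pretzelInvHom (pretzel.arc 8) =
          PresentedGroup.of 0 * ((PresentedGroup.of 0 * (PresentedGroup.of 1)⁻¹) ^ 2)⁻¹ := by
        rw [pretzelInvHom, KnotDiagram.arc, PresentedGroup.toGroup.of]; rfl
      have hc : pretzelInvHom (pretzel.arc 0 * pretzel.arc 5) =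
          PresentedGroup.of 0 * (PresentedGroup.of 1)⁻¹ := by
        rw [map_mul, h0, h5, mul_inv_cancel_left]
      apply PresentedGroup.ext
      intro i
      fin_cases i
      · change pretzelInvHom (pretzelHom (PresentedGroup.of 0)) = PresentedGroup.of 0
        rw [pretzelHom_of.1, map_mul, map_pow, hc, h8, inv_mul_cancel_right]
      · change pretzelInvHom (pretzelHom (PresentedGroup.of 1)) = PresentedGroup.of 1
        rw [pretzelHom_of.2, map_mul, map_mul, map_pow, map_inv, hc, h8]
        simp [mul_assoc])
    (by
      obtain ⟨h1, h2, h3, h4, h5, h6, h7, h9, h10, h11, e1, e2⟩ := pretzel_arc_formulas rfl rfl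
      have hc : pretzelHom (PresentedGroup.of 0 * (PresentedGroup.of 1)⁻¹) =
          pretzel.arc 0 * pretzel.arc 5 := by
        rw [map_mul, map_inv, pretzelHom_of.1, pretzelHom_of.2]
        simp [pow_succ, mul_assoc]
      have hm : pretzelHom ((PresentedGroup.of 0)⁻¹ * PresentedGroup.of 1 ^ 2) =
          pretzel.arc 0 := by
        rw [map_mul, map_inv, map_pow, pretzelHom_of.1, pretzelHom_of.2]
        refine Eq.trans ?_ e1.symm
        simp [pow_succ, mul_assoc]
      have hg : pretzelHom (PresentedGroup.of 0 *
          ((PresentedGroup.of 0 * (PresentedGroup.of 1)⁻¹) ^ 2)⁻¹) = pretzel.arc 8 := by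
        rw [map_mul, map_inv, map_pow, hc, pretzelHom_of.1, mul_inv_cancel_right]
      apply PresentedGroup.ext
      intro k
      change pretzelHom (pretzelInvHom (PresentedGroup.of k)) = pretzel.arc k
      rw [pretzelInvHom, PresentedGroup.toGroup.of]
      clear e1 e2
      fin_cases k
      · exact hm
      · refine Eq.trans ?_ h1.symm
        change pretzelHom (_ ^ 4 * _⁻¹ * (_ ^ 3)⁻¹) = _
        rw [map_mul, map_mul, map_inv, map_inv, map_pow, map_pow, hc, hm]
      · refine Eq.trans ?_ h2.symm
        change pretzelHom (_ ^ 3 * _⁻¹ * (_ ^ 2)⁻¹) = _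
        rw [map_mul, map_mul, map_inv, map_inv, map_pow, map_pow, hc, hm]
      · refine Eq.trans ?_ h3.symm
        change pretzelHom (_ ^ 2 * _⁻¹ * _⁻¹) = _
        rw [map_mul, map_mul, map_inv, map_inv, map_pow, hc, hm]
      · refine Eq.trans ?_ h4.symm
        change pretzelHom (_ * _⁻¹) = _
        rw [map_mul, map_inv, hc, hm]
      · refine Eq.trans ?_ h5.symm
        change pretzelHom (_⁻¹ * _) = _
        rw [map_mul, map_inv, hc, hm]
      · refine Eq.trans ?_ h6.symm
        change pretzelHom (_ * _ * _⁻¹) = _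
        rw [map_mul, map_mul, map_inv, hc, hg]
      · refine Eq.trans ?_ h7.symm
        change pretzelHom (_⁻¹ * (_ * _ * _⁻¹) * _) = _
        rw [map_mul, map_mul, map_mul, map_mul, map_inv, map_inv, hc, hm, hg]
      · exact hg
      · refine Eq.trans ?_ h9.symm
        change pretzelHom (_ ^ 3 * _ * (_ ^ 3)⁻¹) = _
        rw [map_mul, map_mul, map_inv, map_pow, hc, hm]
      · refine Eq.trans ?_ h10.symm
        change pretzelHom (_ ^ 2 * _ * (_ ^ 2)⁻¹) = _
        rw [map_mul, map_mul, map_inv, map_pow, hc, hm]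
      · refine Eq.trans ?_ h11.symm
        change pretzelHom (_ * _ * _⁻¹) = _
        rw [map_mul, map_mul, map_inv, hc, hm])

/-- The generator `a` of the knot group in its presentation `⟨a, b | a² b⁻¹ a² = b² a b²⟩`. -/
def pretzelA : pretzel.KnotGroup := pretzelEquiv (PresentedGroup.of 0)

/-- The generator `b` of the knot group in its presentation `⟨a, b | a² b⁻¹ a² = b² a b²⟩`. -/
def pretzelB : pretzel.KnotGroup := pretzelEquiv (PresentedGroup.of 1)

/-- The meridian and the homological longitude of the diagram are `μ = a⁻¹ b²` and `μ⁻¹⁹ σ` with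
`σ = a b⁻¹ a² b⁻¹ a²`. -/
theorem pretzel_peripheral :
    pretzel.meridian = pretzelA⁻¹ * pretzelB ^ 2 ∧
    pretzel.longitude = (pretzelA⁻¹ * pretzelB ^ 2) ^ (-19 : ℤ) *
      (pretzelA * pretzelB⁻¹ * pretzelA ^ 2 * pretzelB⁻¹ * pretzelA ^ 2) := by
  have hr : pretzelA ^ 2 * pretzelB⁻¹ * pretzelA ^ 2 = pretzelB ^ 2 * pretzelA * pretzelB ^ 2 := by
    have := congrArg pretzelEquiv (pretzelPresentation_relation rfl rfl)
    simpa only [map_mul, map_pow, map_inv, pretzelA, pretzelB] using this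
  have hA : pretzelA = pretzel.arc 8 * (pretzel.arc 0 * pretzel.arc 5) ^ 2 := pretzelHom_of.1
  have hB : pretzelB = (pretzel.arc 0 * pretzel.arc 5)⁻¹ * pretzel.arc 8 *
      (pretzel.arc 0 * pretzel.arc 5) ^ 2 := pretzelHom_of.2
  obtain ⟨h1, h2, h3, h4, h5, h6, h7, h9, h10, h11, e1, e2⟩ := pretzel_arc_formulas rfl rfl
  have hm : pretzel.meridian = pretzelA⁻¹ * pretzelB ^ 2 := by
    rw [hA, hB]
    refine e1.trans ?_
    simp [pow_succ, mul_assoc]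
  refine ⟨hm, ?_⟩
  rw [← hm]
  have hcomm : Commute pretzel.meridian
      (pretzelA * pretzelB⁻¹ * pretzelA ^ 2 * pretzelB⁻¹ * pretzelA ^ 2) := by
    have s1 : pretzelA * pretzelB⁻¹ * pretzelA ^ 2 * pretzelB⁻¹ * pretzelA ^ 2 =
        pretzelA * pretzelB * pretzelA * pretzelB ^ 2 := by
      calc _ = pretzelA * pretzelB⁻¹ * (pretzelA ^ 2 * pretzelB⁻¹ * pretzelA ^ 2) := by
            simp only [mul_assoc]
        _ = _ := by rw [hr]; simp [pow_succ, mul_assoc]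
    have s2 : pretzelA * pretzelB⁻¹ * pretzelA ^ 2 * pretzelB⁻¹ * pretzelA ^ 2 =
        pretzelA⁻¹ * pretzelB ^ 2 * pretzelA * pretzelB * pretzelA ^ 2 := by
      calc _ = pretzelA⁻¹ * (pretzelA ^ 2 * pretzelB⁻¹ * pretzelA ^ 2) * pretzelB⁻¹ *
            pretzelA ^ 2 := by simp [pow_succ, mul_assoc]
        _ = _ := by rw [hr]; simp [pow_succ, mul_assoc]
    change _ * _ = _ * _
    conv_lhs => rw [s1]
    conv_rhs => rw [s2]
    rw [hm]
    simp [pow_succ, mul_assoc]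
  have hsum : -∑ k, (pretzel.sign k : ℤ) = -12 := by simp [pretzel]
  have hprod : (List.ofFn fun k => pretzel.arc (pretzel.overArc k) ^ (pretzel.sign k : ℤ)).prod =
      pretzel.arc 6 * (pretzel.arc 9 * (pretzel.arc 10 * (pretzel.arc 11 * (pretzel.arc 0 *
        (pretzel.arc 8 * (pretzel.arc 0 * (pretzel.arc 5 * (pretzel.arc 6 * (pretzel.arc 2 *
          (pretzel.arc 3 * pretzel.arc 4)))))))))) := by
    change List.prod [pretzel.arc 6 ^ (1 : ℤ), pretzel.arc 9 ^ (1 : ℤ), pretzel.arc 10 ^ (1 : ℤ),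
        pretzel.arc 11 ^ (1 : ℤ), pretzel.arc 0 ^ (1 : ℤ), pretzel.arc 8 ^ (1 : ℤ),
        pretzel.arc 0 ^ (1 : ℤ), pretzel.arc 5 ^ (1 : ℤ), pretzel.arc 6 ^ (1 : ℤ),
        pretzel.arc 2 ^ (1 : ℤ), pretzel.arc 3 ^ (1 : ℤ), pretzel.arc 4 ^ (1 : ℤ)] = _
    simp only [zpow_one, List.prod_cons, List.prod_nil, mul_one]
  have key : pretzel.arc 6 * (pretzel.arc 9 * (pretzel.arc 10 * (pretzel.arc 11 * (pretzel.arc 0 *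
        (pretzel.arc 8 * (pretzel.arc 0 * (pretzel.arc 5 * (pretzel.arc 6 * (pretzel.arc 2 *
          (pretzel.arc 3 * pretzel.arc 4)))))))))) * pretzel.arc 0 ^ 3 =
      (pretzel.arc 0 ^ 4)⁻¹ *
        (pretzelA * pretzelB⁻¹ * pretzelA ^ 2 * pretzelB⁻¹ * pretzelA ^ 2) := by
    rw [h2, h3, h4, h6, h9, h10, h11, hA, hB]
    clear h1 h2 h3 h4 h6 h7 h9 h10 h11 hsum hprod hcomm hA hB hr hm
    generalize pretzel.arc 0 * pretzel.arc 5 = c at *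
    rw [h5]
    clear h5
    generalize pretzel.arc 0 = x, pretzel.arc 8 = g at *
    have hx : c * g * c ^ 2 * (c * x⁻¹) * (c * g * c ^ 2)⁻¹ = x := by
      conv_lhs => rw [e1]
      rw [e2]; simp [pow_succ, mul_assoc]
    have hx4 : c * g * c ^ 2 * (c * x⁻¹) ^ 4 * (c * g * c ^ 2)⁻¹ = x ^ 4 := by
      rw [← conj_pow, hx]
    rw [← hx4]
    simp [pow_succ, mul_assoc]
  have hx0 : pretzel.meridian = pretzel.arc 0 := rfl
  rw [KnotDiagram.longitude, hsum, hprod]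
  rw [hx0] at hcomm ⊢
  rw [← eq_mul_inv_iff_mul_eq] at key
  rw [key]
  generalize pretzelA * pretzelB⁻¹ * pretzelA ^ 2 * pretzelB⁻¹ * pretzelA ^ 2 = s at *
  generalize pretzel.arc 0 = x at *
  have hz : Commute (x ^ (-15 : ℤ)) s := hcomm.zpow_left _
  calc (x ^ 4)⁻¹ * s * (x ^ 3)⁻¹ * x ^ (-12 : ℤ) = (x ^ 4)⁻¹ * (s * x ^ (-15 : ℤ)) := by
        have p : x ^ (-15 : ℤ) = (x ^ 3)⁻¹ * x ^ (-12 : ℤ) := by group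
        rw [p]; simp only [mul_assoc]
    _ = (x ^ 4)⁻¹ * (x ^ (-15 : ℤ) * s) := by rw [hz.eq]
    _ = x ^ (-19 : ℤ) * s := by
        have p : x ^ (-19 : ℤ) = (x ^ 4)⁻¹ * x ^ (-15 : ℤ) := by group
        rw [p]; simp only [mul_assoc]

end

noncomputable section

/-! ### The root of the Alexander polynomial -/

/-! By Cayley–Hamilton, both sides of a²b⁻¹a² = b²ab² become linear combinations of A, B and 1 whose
coefficients are polynomials in t = tr A, s = tr B, r = tr AB. For s = t/(t²-1) and r = 1-1/t² the
coefficients agree (`SU11.pretzel_relation_of_traces`), so t parametrizes a curve of trace data that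
representations realize. With A diagonal and B in polar form, the traces force the angles α, β and
the radius R, and the pair exists in SU(1,1) as long as R² ≥ 0. By `curve_radius`, R² has the sign
of a quintic in t² that increases on the relevant range. Where R = 0 the representation is diagonal;
where R ≠ 0 it is irreducible.

The zero of R is the abelian endpoint. There a and b go to the fifth and third powers of diag(z,
z⁻¹), z = e^{iθ/2}, with traces 2cos(5θ/2), 2cos(3θ/2), and 2cos 4θ for ab. The two equations of the
trace curve then become multiples of a quintic in y = 2cos θ, the Alexander polynomial written in T
+ T⁻¹ (`abelian_traces`, `curve_endpoint`). Its root is located by the intermediate value theorem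
with Taylor bounds, and an explicit kernel vector of the Alexander matrix links it to the diagram.

For ellipticity, the peripheral subgroup is abelian, and in SU(1,1) whatever commutes with an
elliptic element is central or elliptic. Hence only the meridian trace t³/(t²-1)² - 1/t - t matters.
It stays in (-2, 2) until it reaches 2, at the root t₁ of a cubic. -/

theorem Real.abs_cos_sub_taylor_le {x : ℝ} (hx : |x| ≤ 7) :
    |Real.cos x - (1 - x ^ 2 / 2 + x ^ 4 / 24 - x ^ 6 / 720 + x ^ 8 / 40320 - x ^ 10 / 3628800
      + x ^ 12 / 479001600)| ≤ |x| ^ 14 / 87178291200 * 2 := by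
  have hn : ‖(x : ℂ) * Complex.I‖ = |x| := by simp
  -- cos x is the real part of exp(ix). Order 14 requires |x| ≤ 7.5 and leaves a remainder of about
  -- 5·10⁻⁷ at |x| ≈ 2.045, where it is needed.
  have h := Complex.exp_bound' (x := (x : ℂ) * Complex.I) (n := 14) (by
    rw [hn]; norm_num; linarith)
  rw [hn] at h
  have h2 := (Complex.abs_re_le_norm _).trans h
  have hI : ∀ k : ℕ, Complex.I ^ (k + 2) = -Complex.I ^ k := fun k => by
    rw [pow_add, Complex.I_sq]; ring
  have hs : ∑ m ∈ Finset.range 14, ((x : ℂ) * Complex.I) ^ m / (m.factorial : ℂ) =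
      ((1 - x ^ 2 / 2 + x ^ 4 / 24 - x ^ 6 / 720 + x ^ 8 / 40320 - x ^ 10 / 3628800
        + x ^ 12 / 479001600 : ℝ) : ℂ) + ((x - x ^ 3 / 6 + x ^ 5 / 120 - x ^ 7 / 5040
        + x ^ 9 / 362880 - x ^ 11 / 39916800 + x ^ 13 / 6227020800 : ℝ) : ℂ) * Complex.I := by
    simp only [Finset.sum_range_succ, Finset.sum_range_zero, mul_pow, hI, Nat.factorial]
    push_cast
    ring
  rw [hs, Complex.sub_re, Complex.exp_ofReal_mul_I_re, Complex.add_re, Complex.ofReal_re,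
    Complex.re_ofReal_mul, Complex.I_re, mul_zero, add_zero] at h2
  refine h2.trans (le_of_eq ?_)
  norm_num [Nat.factorial]

/-- The Alexander polynomial of the pretzel knot, written in terms of `y = T + T⁻¹`. -/
def alexanderTrace (y : ℝ) : ℝ := y ^ 5 - y ^ 4 - 5 * y ^ 3 + 5 * y ^ 2 + 4 * y - 3

/-- The quintic changes sign between the two ends of the allowed window for θ. -/
theorem exists_alexanderTrace_root :
    ∃ θ : ℝ, |θ - 2.0453| ≤ 0.00005 ∧ -0.9139 ≤ 2 * Real.cos θ ∧ 2 * Real.cos θ ≤ -0.9137 ∧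
      alexanderTrace (2 * Real.cos θ) = 0 := by
  have c1 : |2 * Real.cos 2.04525 - -0.91370507| ≤ 0.000002 := by
    have h := Real.abs_cos_sub_taylor_le (x := 2.04525) (by norm_num [abs_of_pos])
    rw [abs_le] at h ⊢
    norm_num [abs_of_pos] at h ⊢
    constructor <;> linarith [h.1, h.2]
  have c2 : |2 * Real.cos 2.04535 - -0.91388297| ≤ 0.000002 := by
    have h := Real.abs_cos_sub_taylor_le (x := 2.04535) (by norm_num [abs_of_pos])
    rw [abs_le] at h ⊢
    norm_num [abs_of_pos] at h ⊢
    constructor <;> linarith [h.1, h.2]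
  rw [abs_le] at c1 c2
  -- The divided difference is bounded below termwise: 5(y²+yz+z²) and -5(y+z) outweigh the rest.
  have hq : ∀ y z : ℝ, -0.914 ≤ y → y < z → z ≤ -0.913 → alexanderTrace z < alexanderTrace y := by
    intro y z hy hyz hz
    have e : alexanderTrace y - alexanderTrace z = (z - y) *
      (-(y ^ 4 + y ^ 3 * z + y ^ 2 * z ^ 2 + y * z ^ 3 + z ^ 4) + (y + z) * (y ^ 2 + z ^ 2)
        + 5 * (y ^ 2 + y * z + z ^ 2) - 5 * (y + z) - 4) := by
      unfold alexanderTrace; ring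
    have y2 : 0.833 ≤ y ^ 2 ∧ y ^ 2 ≤ 0.836 := by constructor <;> nlinarith
    have z2 : 0.833 ≤ z ^ 2 ∧ z ^ 2 ≤ 0.836 := by constructor <;> nlinarith
    have yz : 0.833 ≤ y * z ∧ y * z ≤ 0.836 := by constructor <;> nlinarith
    have y4 : y ^ 4 ≤ 0.7 := by nlinarith [y2.1, y2.2]
    have z4 : z ^ 4 ≤ 0.7 := by nlinarith [z2.1, z2.2]
    have y3z : y ^ 3 * z ≤ 0.7 := by nlinarith [y2.1, y2.2, yz.1, yz.2]
    have yz3 : y * z ^ 3 ≤ 0.7 := by nlinarith [z2.1, z2.2, yz.1, yz.2]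
    have y2z2 : y ^ 2 * z ^ 2 ≤ 0.7 := by nlinarith [z2.1, z2.2, y2.1, y2.2]
    have hc : -4 ≤ (y + z) * (y ^ 2 + z ^ 2) := by nlinarith [z2.1, z2.2, y2.1, y2.2]
    have := mul_pos (sub_pos.2 hyz) (show 0 <
      (-(y ^ 4 + y ^ 3 * z + y ^ 2 * z ^ 2 + y * z ^ 3 + z ^ 4) + (y + z) * (y ^ 2 + z ^ 2)
        + 5 * (y ^ 2 + y * z + z ^ 2) - 5 * (y + z) - 4) by linarith [y2.1, z2.1, yz.1])
    linarith
  have hcont : ContinuousOn (fun θ : ℝ => alexanderTrace (2 * Real.cos θ))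
      (Set.Icc 2.04525 2.04535) := by
    unfold alexanderTrace; fun_prop
  -- The cosines are known only to within an error, so the sign is computed at a rational point just
  -- outside the enclosure and carried over by monotonicity.
  have s1 : alexanderTrace (2 * Real.cos 2.04525) ≤ 0 :=
    (hq (-0.913708) _ (by norm_num) (by linarith) (by linarith)).le.trans
      (by norm_num [alexanderTrace])
  have s2 : 0 ≤ alexanderTrace (2 * Real.cos 2.04535) :=
    le_trans (by norm_num [alexanderTrace])
      (hq _ (-0.91388) (by linarith) (by linarith) (by norm_num)).le
  obtain ⟨θ, hθ, h0⟩ := intermediate_value_Icc (by norm_num) hcont ⟨s1, s2⟩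
  have hpi := Real.pi_gt_d2
  have m1 := Real.cos_le_cos_of_nonneg_of_le_pi (x := 2.04525) (y := θ) (by norm_num)
    (by linarith [hθ.2]) hθ.1
  have m2 := Real.cos_le_cos_of_nonneg_of_le_pi (x := θ) (y := 2.04535) (by linarith [hθ.1])
    (by linarith) hθ.2
  refine ⟨θ, ?_, by linarith, by linarith, h0⟩
  rw [abs_le]
  constructor <;> linarith [hθ.1, hθ.2]

/-- A square matrix with a nonzero kernel vector has determinant zero, so one vector `w` replaces
the expansion of an 11 × 11 determinant. -/
theorem pretzel_aeval_alexanderPolynomial_eq_zero {x : ℂ} (h0 : x ≠ 0) (h1 : x ≠ 1)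
    (h : x ^ 10 - x ^ 9 + x ^ 7 - x ^ 6 + x ^ 5 - x ^ 4 + x ^ 3 - x + 1 = 0) :
    Polynomial.aeval x pretzel.alexanderPolynomial = 0 := by
  -- Nine of the eleven rows solve for one entry each, starting from the entries p and q at arcs 5
  -- and 8. The row of arc 5 fixes the ratio p : q, which explains these two polynomials. The row of
  -- arc 8 is left over and evaluates to minus the polynomial in `h`.
  let p := x ^ 3 - x + 1
  let q := 1 - x ^ 2 + x ^ 3
  let v4 := x * p
  let v11 := (1 - x) * v4
  let v3 := x * v4 + (1 - x) * v11
  let v10 := x * v11 + (1 - x) * v3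
  let v2 := x * v3 + (1 - x) * v10
  let v9 := x * v10 + (1 - x) * v2
  let v1 := x * v2 + (1 - x) * v9
  let v7 := x * q + (1 - x) * p
  let v6 := x * v7
  let w : Fin 11 → ℂ := ![v1, v2, v3, v4, p, v6, v7, q, v9, v10, v11]
  rw [KnotDiagram.alexanderPolynomial, AlgHom.map_det]
  refine Matrix.exists_mulVec_eq_zero_iff.1 ⟨w, ?_, ?_⟩
  · intro hw
    have hp : p = 0 := congrFun hw 4
    have hq : q = 0 := congrFun hw 7
    have : x * (x - 1) = 0 := by linear_combination hp - hq
    rcases mul_eq_zero.1 this with h | h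
    · exact h0 h
    · exact h1 (sub_eq_zero.1 h)
  · ext i
    have key : ∀ i j : Fin 11, ((Polynomial.aeval x : ℤ[X] →ₐ[ℤ] ℂ).mapMatrix
        (pretzel.alexanderMatrix.submatrix Fin.succ Fin.succ)) i j =
        (if j.succ = i.succ + 1 then x else 0) +
          (if j.succ = pretzel.overArc i.succ then 1 - x else 0) -
          (if j.succ = i.succ then 1 else 0) := by
      intro i j
      have hs : pretzel.sign i.succ = 1 := rfl
      simp only [AlgHom.mapMatrix_apply, Matrix.map_apply, Matrix.submatrix_apply,
        KnotDiagram.alexanderMatrix, hs, if_true, map_sub, map_add, apply_ite (Polynomial.aeval x),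
        Polynomial.aeval_X, map_zero, map_one]
    -- Extending `w` by 0 at the deleted arc turns each row into a sum of Kronecker deltas over all
    -- twelve arcs.
    let u : Fin 12 → ℂ := Fin.cons 0 w
    have hsum : ∀ f : Fin 12 → ℂ, ∑ j : Fin 11, f j.succ * w j = ∑ j, f j * u j := by
      intro f
      rw [Fin.sum_univ_succ (fun j => f j * u j)]
      simp [u]
    simp only [Matrix.mulVec, dotProduct, key, Pi.zero_apply]
    rw [hsum fun j => (if j = i.succ + 1 then x else 0) +
          (if j = pretzel.overArc i.succ then 1 - x else 0) - (if j = i.succ then 1 else 0)]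
    simp only [add_mul, sub_mul, ite_mul, zero_mul, one_mul, Finset.sum_add_distrib,
      Finset.sum_sub_distrib, Finset.sum_ite_eq', Finset.mem_univ, if_true]
    fin_cases i
    · change x * v2 + (v9 - x * v9) - v1 = 0
      ring
    · change x * v3 + (v10 - x * v10) - v2 = 0
      ring
    · change x * v4 + (v11 - x * v11) - v3 = 0
      ring
    · change x * p + (0 - x * 0) - v4 = 0
      ring
    · change x * v6 + (q - x * q) - p = 0
      ring
    · change x * v7 + (0 - x * 0) - v6 = 0
      ring
    · change x * q + (p - x * p) - v7 = 0
      ring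
    · change x * v9 + (v6 - x * v6) - q = 0
      linear_combination -h
    · change x * v10 + (v2 - x * v2) - v9 = 0
      ring
    · change x * v11 + (v3 - x * v3) - v10 = 0
      ring
    · change x * 0 + (v4 - x * v4) - v11 = 0
      ring

/-- The degree-ten polynomial is palindromic, equal to x⁵ times `alexanderTrace` at x + x⁻¹ = 2cos
θ. -/
theorem aeval_alexanderPolynomial_of_alexanderTrace {θ : ℝ} (hy : 2 * Real.cos θ ≠ 2)
    (h : alexanderTrace (2 * Real.cos θ) = 0) :
    Polynomial.aeval (Complex.exp (θ * Complex.I)) pretzel.alexanderPolynomial = 0 := by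
  set x := Complex.exp (θ * Complex.I) with hx
  have h0 : x ≠ 0 := Complex.exp_ne_zero _
  have hc : ((2 * Real.cos θ : ℝ) : ℂ) = x + x⁻¹ := by
    rw [hx, ← Complex.exp_neg]
    push_cast
    rw [Complex.cos, neg_mul]
    ring
  refine pretzel_aeval_alexanderPolynomial_eq_zero h0 (fun h1 => hy ?_) ?_
  · rw [h1] at hc
    have : ((2 * Real.cos θ : ℝ) : ℂ) = ((2 : ℝ) : ℂ) := by rw [hc]; norm_num
    exact_mod_cast this
  · have h2 : ((alexanderTrace (2 * Real.cos θ) : ℝ) : ℂ) = 0 := by rw [h]; simp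
    have h3 : (x + x⁻¹) ^ 5 - (x + x⁻¹) ^ 4 - 5 * (x + x⁻¹) ^ 3 + 5 * (x + x⁻¹) ^ 2
        + 4 * (x + x⁻¹) - 3 = 0 := by
      rw [← hc, ← h2, alexanderTrace]; push_cast; ring
    have h4 := congrArg (x ^ 5 * ·) h3
    simp only [mul_zero] at h4
    rw [← h4]
    field_simp
    ring

/-- The double-angle data at the root of the Alexander polynomial: with `t = 2 cos (5θ/2)`, the
traces of the abelian representation satisfy the equations of the trace curve. -/
theorem abelian_traces {θ t : ℝ} (h : alexanderTrace (2 * Real.cos θ) = 0)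
    (ht : t = 2 * Real.cos (5 * θ / 2)) :
    2 * Real.cos (3 * θ / 2) * (t ^ 2 - 1) = t ∧ 2 * Real.cos (4 * θ) * t ^ 2 = t ^ 2 - 1 ∧
      t ^ 2 = (2 * Real.cos θ + 2) * ((2 * Real.cos θ) ^ 2 - 2 * Real.cos θ - 1) ^ 2 := by
  set w := 2 * Real.cos (θ / 2) with hw
  set y := 2 * Real.cos θ with hy
  have e1 : w ^ 2 = y + 2 := by
    have : Real.cos θ = 2 * Real.cos (θ / 2) ^ 2 - 1 := by
      rw [← Real.cos_two_mul]; congr 1; ring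
    rw [hw, hy, this]; ring
  have hstep : ∀ φ : ℝ, 2 * Real.cos (φ + θ) = y * (2 * Real.cos φ) - 2 * Real.cos (φ - θ) := by
    intro φ
    rw [Real.cos_add, Real.cos_sub, hy]; ring
  have c3 : 2 * Real.cos (3 * θ / 2) = w * (y - 1) := by
    have := hstep (θ / 2)
    rw [show θ / 2 + θ = 3 * θ / 2 by ring, show θ / 2 - θ = -(θ / 2) by ring, Real.cos_neg] at this
    rw [this]; ring
  have c5 : t = w * (y ^ 2 - y - 1) := by
    have := hstep (3 * θ / 2)
    rw [show 3 * θ / 2 + θ = 5 * θ / 2 by ring, show 3 * θ / 2 - θ = θ / 2 by ring, c3] at this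
    rw [ht, this]; ring
  have c4 : 2 * Real.cos (4 * θ) = y ^ 4 - 4 * y ^ 2 + 2 := by
    rw [show 4 * θ = 2 * (2 * θ) by ring, Real.cos_two_mul, Real.cos_two_mul, hy]; ring
  have ht2 : t ^ 2 = (y + 2) * (y ^ 2 - y - 1) ^ 2 := by rw [c5, mul_pow, e1]
  unfold alexanderTrace at h
  refine ⟨?_, ?_, ht2⟩
  -- After substitution, each trace equation is a multiple of the quintic; the cofactors are the
  -- quotients of polynomial division.
  · rw [c3, ht2, c5]
    linear_combination w * y * h
  · rw [c4, ht2]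
    linear_combination (y ^ 4 + y ^ 3 - 3 * y ^ 2 - 3 * y - 1) * h

/-! ### Elements of `SU(1,1)` -/

namespace SU11

theorem toMatrix_injective : Function.Injective SU11.toMatrix := fun _ _ h =>
  Subtype.ext (Subtype.ext h)

theorem toMatrix_mul (A B : SU11) : toMatrix (A * B) = toMatrix A * toMatrix B := rfl

theorem toMatrix_one : toMatrix 1 = 1 := rfl

theorem toMatrix_inv (A : SU11) : toMatrix (A⁻¹) = (tr A) • 1 - toMatrix A := by
  change (((A : Matrix.SpecialLinearGroup (Fin 2) ℂ)⁻¹ : Matrix.SpecialLinearGroup (Fin 2) ℂ) :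
    Matrix (Fin 2) (Fin 2) ℂ) = _
  rw [Matrix.SpecialLinearGroup.coe_inv, Matrix.adjugate_fin_two]
  ext i j
  fin_cases i <;> fin_cases j <;> simp [tr, toMatrix, Matrix.trace_fin_two]

theorem sq_toMatrix (A : SU11) : toMatrix A * toMatrix A = (tr A) • toMatrix A - 1 := by
  have h : toMatrix A * toMatrix (A⁻¹) = 1 := by rw [← toMatrix_mul, mul_inv_cancel]; rfl
  rw [toMatrix_inv, Matrix.mul_sub, Matrix.mul_smul, mul_one] at h
  rw [← h]; abel

/-- Invariance of the form J means A*J = JA⁻¹; comparing entries with the adjugate gives this shape.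
-/
theorem exists_entries (A : SU11) : ∃ p q : ℂ,
    toMatrix A = !![p, q; (starRingEnd ℂ) q, (starRingEnd ℂ) p] ∧
      Complex.normSq p - Complex.normSq q = 1 := by
  have hinv : toMatrix A * toMatrix (A⁻¹) = 1 := by rw [← toMatrix_mul, mul_inv_cancel]; rfl
  have hA : (toMatrix A)ᴴ * gramOneOne * toMatrix A = gramOneOne := A.2
  have h : (toMatrix A)ᴴ * gramOneOne = gramOneOne * toMatrix (A⁻¹) := by
    rw [← hA, Matrix.mul_assoc _ (toMatrix A), hinv, mul_one, hA]
  rw [toMatrix_inv, tr] at h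
  have hdet : (toMatrix A).det = 1 := (A : Matrix.SpecialLinearGroup (Fin 2) ℂ).2
  generalize toMatrix A = M at *
  rw [Matrix.det_fin_two] at hdet
  have e00 := congrFun (congrFun h 0) 0
  have e01 := congrFun (congrFun h 0) 1
  simp [gramOneOne, Matrix.mul_apply, Fin.sum_univ_two, Matrix.trace_fin_two] at e00 e01
  refine ⟨M 0 0, M 0 1, ?_, ?_⟩
  · have e10 : (starRingEnd ℂ) (M 0 1) = M 1 0 := by
      have := congrArg (starRingEnd ℂ) e01
      simpa using this.symm
    rw [e00, e10]
    ext i j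
    fin_cases i <;> fin_cases j <;> rfl
  · have e10 : (starRingEnd ℂ) (M 0 1) = M 1 0 := by
      have := congrArg (starRingEnd ℂ) e01
      simpa using this.symm
    have : ((Complex.normSq (M 0 0) - Complex.normSq (M 0 1) : ℝ) : ℂ) = 1 := by
      push_cast
      rw [← Complex.mul_conj, ← Complex.mul_conj, e00, e10, hdet]
    exact_mod_cast this

/-- An elliptic isometry has a single fixed point, which its centralizer must fix. In entries (p, q)
of A and (u, v) of B, commutation gives Im p · v = Im u · q. -/
theorem isCentral_or_isElliptic_of_commute {A B : SU11} (hA : IsElliptic A) (h : Commute A B) :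
    IsCentral B ∨ IsElliptic B := by
  obtain ⟨p, q, hM, hn⟩ := exists_entries A
  obtain ⟨u, v, hN, hn'⟩ := exists_entries B
  have hc : toMatrix A * toMatrix B = toMatrix B * toMatrix A := congrArg toMatrix h.eq
  have htr : ∀ z : ℂ, ‖z + (starRingEnd ℂ) z‖ = |2 * z.re| := by
    intro z
    rw [Complex.add_conj, Complex.norm_real, Real.norm_eq_abs]
  unfold IsElliptic IsCentral tr at *
  rw [hN]
  rw [hM] at hA
  rw [hM, hN] at hc
  rw [Matrix.trace_fin_two_of, htr, abs_lt] at hA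
  rw [Matrix.trace_fin_two_of, htr, abs_lt]
  have e01 := congrFun (congrFun hc 0) 1
  simp only [Matrix.mul_apply, Fin.sum_univ_two, Matrix.of_apply, Matrix.cons_val',
    Matrix.cons_val_zero,
    Matrix.cons_val_one, Matrix.cons_val_fin_one] at e01
  have e2 : ((2 * p.im : ℝ) : ℂ) * Complex.I * v = ((2 * u.im : ℝ) : ℂ) * Complex.I * q := by
    rw [← Complex.sub_conj, ← Complex.sub_conj]; linear_combination e01
  have e3 : (p.im : ℂ) * v = u.im * q := by
    have : (2 * Complex.I) * ((p.im : ℂ) * v) = (2 * Complex.I) * (u.im * q) := by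
      push_cast at e2; linear_combination e2
    exact mul_left_cancel₀ (by simp) this
  have e4 := congrArg Complex.normSq e3
  simp only [map_mul, Complex.normSq_ofReal] at e4
  rw [Complex.normSq_apply p] at hn
  rw [Complex.normSq_apply u] at hn'
  have hq := Complex.normSq_nonneg q
  -- Given |p|² - |q|² = 1, ellipticity |Re p| < 1 is the same as |q|² < (Im p)².
  have hp : 0 < p.im * p.im - Complex.normSq q := by nlinarith
  have hp0 : p.im ≠ 0 := by rintro h; rw [h] at hp; linarith
  by_cases hu : u.im = 0
  · left
    have hv : v = 0 := by
      rw [hu] at e3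
      simpa [hp0] using e3
    subst hv
    rw [hu] at hn'
    have hu' : u = u.re := by apply Complex.ext <;> simp [hu]
    have : (u.re - 1) * (u.re + 1) = 0 := by simp at hn'; linarith
    rcases mul_eq_zero.1 this with h | h
    · left
      have : u = 1 := by rw [hu', sub_eq_zero.1 h]; simp
      subst this
      ext i j; fin_cases i <;> fin_cases j <;> simp
    · right
      have : u = -1 := by rw [hu', eq_neg_of_add_eq_zero_left h]; simp
      subst this
      ext i j; fin_cases i <;> fin_cases j <;> simp
  · right
    have hpos : 0 < u.im * u.im * (p.im * p.im - Complex.normSq q) :=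
      mul_pos (mul_self_pos.2 hu) hp
    have hpp := mul_self_pos.2 hp0
    have : 0 < (p.im * p.im) * (1 - u.re * u.re) := by nlinarith
    have := (mul_pos_iff_of_pos_left hpp).1 this
    constructor <;> nlinarith

/-- The element of `SU(1,1)` with polar data: argument `φ` of the diagonal, real off-diagonal
entry `r`. -/
def polar (φ r : ℝ) : SU11 :=
  ⟨⟨!![Real.sqrt (1 + r ^ 2) * Complex.exp (φ * Complex.I), (r : ℂ);
      (r : ℂ), Real.sqrt (1 + r ^ 2) * Complex.exp (-(φ * Complex.I))], by
    have h : ((Real.sqrt (1 + r ^ 2) : ℝ) : ℂ) * (Real.sqrt (1 + r ^ 2) : ℝ) = 1 + r ^ 2 := by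
      rw [← Complex.ofReal_mul, Real.mul_self_sqrt (by positivity)]; push_cast; rfl
    have h' : Complex.exp (φ * Complex.I) * Complex.exp (-(φ * Complex.I)) = 1 := by
      rw [← Complex.exp_add, add_neg_cancel, Complex.exp_zero]
    rw [Matrix.det_fin_two_of]
    linear_combination Complex.exp (φ * Complex.I) * Complex.exp (-(φ * Complex.I)) * h
      + (1 + (r : ℂ) ^ 2) * h'⟩, by
    have h : ((Real.sqrt (1 + r ^ 2) : ℝ) : ℂ) * (Real.sqrt (1 + r ^ 2) : ℝ) = 1 + r ^ 2 := by
      rw [← Complex.ofReal_mul, Real.mul_self_sqrt (by positivity)]; push_cast; rfl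
    have h' : Complex.exp (φ * Complex.I) * Complex.exp (-(φ * Complex.I)) = 1 := by
      rw [← Complex.exp_add, add_neg_cancel, Complex.exp_zero]
    have c1 : (starRingEnd ℂ) (Complex.exp (φ * Complex.I)) =
        Complex.exp (-(φ * Complex.I)) := by
      rw [← Complex.exp_conj]; simp
    have c2 : (starRingEnd ℂ) (Complex.exp (-(φ * Complex.I))) =
        Complex.exp (φ * Complex.I) := by
      rw [← Complex.exp_conj]; simp
    change (!![Real.sqrt (1 + r ^ 2) * Complex.exp (φ * Complex.I), (r : ℂ);
      (r : ℂ), Real.sqrt (1 + r ^ 2) * Complex.exp (-(φ * Complex.I))])ᴴ * gramOneOne *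
      !![Real.sqrt (1 + r ^ 2) * Complex.exp (φ * Complex.I), (r : ℂ);
      (r : ℂ), Real.sqrt (1 + r ^ 2) * Complex.exp (-(φ * Complex.I))] = gramOneOne
    generalize Complex.exp (φ * Complex.I) = e, Complex.exp (-(φ * Complex.I)) = e' at *
    ext i j
    fin_cases i <;> fin_cases j <;>
      simp [gramOneOne, Matrix.mul_apply, Fin.sum_univ_two, c1, c2]
    · linear_combination e * e' * h + (1 + (r : ℂ) ^ 2) * h'
    · ring
    · ring
    · linear_combination -(e * e' * h + (1 + (r : ℂ) ^ 2) * h')⟩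

theorem toMatrix_polar (φ r : ℝ) : toMatrix (polar φ r) =
    !![Real.sqrt (1 + r ^ 2) * Complex.exp (φ * Complex.I), (r : ℂ);
      (r : ℂ), Real.sqrt (1 + r ^ 2) * Complex.exp (-(φ * Complex.I))] := rfl

end SU11

/-! ### Polar elements, trace identities and irreducibility criteria -/

namespace SU11

theorem polar_zero (φ : ℝ) : polar φ 0 = diag (Circle.exp φ) := by
  apply toMatrix_injective
  rw [toMatrix_polar]
  change _ = !![((Circle.exp φ : Circle) : ℂ), 0; 0, (((Circle.exp φ)⁻¹ : Circle) : ℂ)]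
  rw [← Circle.exp_neg, Circle.coe_exp, Circle.coe_exp]
  simp

theorem diag_pow (z : Circle) (n : ℕ) : diag z ^ n = diag (z ^ n) := by
  induction n with
  | zero =>
    apply toMatrix_injective
    rw [pow_zero, pow_zero]
    change (1 : Matrix (Fin 2) (Fin 2) ℂ) = !![((1 : Circle) : ℂ), 0; 0, ((1⁻¹ : Circle) : ℂ)]
    ext i j; fin_cases i <;> fin_cases j <;> simp
  | succ k ih =>
    rw [pow_succ, ih]
    apply toMatrix_injective
    change !![((z ^ k : Circle) : ℂ), 0; 0, (((z ^ k)⁻¹ : Circle) : ℂ)] *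
      !![(z : ℂ), 0; 0, ((z⁻¹ : Circle) : ℂ)] =
      !![((z ^ (k + 1) : Circle) : ℂ), 0; 0, (((z ^ (k + 1))⁻¹ : Circle) : ℂ)]
    ext i j
    fin_cases i <;> fin_cases j <;> simp [Matrix.mul_apply, pow_succ, mul_comm]

theorem continuous_polar : Continuous fun x : ℝ × ℝ => polar x.1 x.2 := by
  refine Continuous.subtype_mk (Continuous.subtype_mk ?_ _) _
  refine continuous_matrix fun i j => ?_
  fin_cases i <;> fin_cases j <;> simp <;> fun_prop

theorem tr_polar (φ r : ℝ) :
    tr (polar φ r) = ((2 * Real.sqrt (1 + r ^ 2) * Real.cos φ : ℝ) : ℂ) := by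
  rw [tr, toMatrix_polar, Matrix.trace_fin_two_of]
  push_cast
  rw [Complex.cos, neg_mul]
  ring

theorem tr_polar_zero_mul (ψ φ r : ℝ) :
    tr (polar ψ 0 * polar φ r) = ((2 * Real.sqrt (1 + r ^ 2) * Real.cos (ψ + φ) : ℝ) : ℂ) := by
  rw [tr, toMatrix_mul, toMatrix_polar, toMatrix_polar, Matrix.trace_fin_two]
  push_cast
  rw [Complex.cos, neg_mul, add_mul, neg_add, Complex.exp_add, Complex.exp_add]
  simp [Matrix.mul_apply, Fin.sum_univ_two]
  ring

/-- Cayley–Hamilton for AB, multiplied on the right by B⁻¹ = tr B - B. -/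
theorem toMatrix_mul_mul_self (A B : SU11) :
    toMatrix A * toMatrix B * toMatrix A = tr (A * B) • toMatrix A + toMatrix B - tr B • 1 := by
  have hdet : (toMatrix A).det = 1 := (A : Matrix.SpecialLinearGroup (Fin 2) ℂ).2
  rw [tr, tr, toMatrix_mul]
  generalize toMatrix A = M at *
  generalize toMatrix B = N at *
  rw [Matrix.det_fin_two] at hdet
  ext i j
  fin_cases i <;> fin_cases j <;>
    simp [Matrix.mul_apply, Fin.sum_univ_two, Matrix.trace_fin_two]
  · linear_combination -N 1 1 * hdet
  · linear_combination N 0 1 * hdet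
  · linear_combination N 1 0 * hdet
  · linear_combination -N 0 0 * hdet

theorem toMatrix_mul_add_mul (A B : SU11) :
    toMatrix A * toMatrix B + toMatrix B * toMatrix A =
      tr A • toMatrix B + tr B • toMatrix A + (tr (A * B) - tr A * tr B) • 1 := by
  rw [tr, tr, tr, toMatrix_mul]
  generalize toMatrix A = M at *
  generalize toMatrix B = N at *
  ext i j
  fin_cases i <;> fin_cases j <;>
    simp [Matrix.mul_apply, Fin.sum_univ_two, Matrix.trace_fin_two] <;> ring

theorem tr_mul_comm (A B : SU11) : tr (A * B) = tr (B * A) := by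
  rw [tr, tr, toMatrix_mul, toMatrix_mul, Matrix.trace_mul_comm]

/-- Replacing A², B², ABA, BAB and AB + BA by their Cayley–Hamilton expressions reduces both sides
to A - B - sr. -/
theorem pretzel_relation_of_traces {A B : SU11} {t : ℂ} (h0 : t ≠ 0) (h1 : t ^ 2 - 1 ≠ 0)
    (hA : tr A = t) (hB : tr B = t / (t ^ 2 - 1)) (hAB : tr (A * B) = 1 - 1 / t ^ 2) :
    A ^ 2 * B⁻¹ * A ^ 2 = B ^ 2 * A * B ^ 2 := by
  apply toMatrix_injective
  have k1 := sq_toMatrix A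
  have k2 := sq_toMatrix B
  have k3 := toMatrix_mul_mul_self A B
  have k4 := toMatrix_mul_mul_self B A
  have k5 := toMatrix_mul_add_mul A B
  rw [tr_mul_comm B A] at k4
  simp only [toMatrix_mul, pow_two, toMatrix_inv]
  rw [hA] at *
  generalize tr B = s at *
  generalize tr (A * B) = r at *
  -- These three identities match the coefficients of A, of B and of 1.
  have q1 : s * (t ^ 3 - t) - t ^ 2 * r = 1 := by rw [hB, hAB]; field_simp; ring
  have q2 : s ^ 2 * r - s * t = -1 := by rw [hB, hAB]; field_simp; ring
  have q3 : s * (1 - t ^ 2) + t * r = -(s * r) := by rw [hB, hAB]; field_simp; ring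
  generalize toMatrix A = a at *
  generalize toMatrix B = b at *
  rw [k1, k2]
  have e1 : (t • a - 1) * (s • (1 : Matrix (Fin 2) (Fin 2) ℂ) - b) * (t • a - 1) =
      (s * t ^ 2) • (a * a) - (2 * s * t) • a + s • (1 : Matrix (Fin 2) (Fin 2) ℂ)
        - t ^ 2 • (a * b * a) + t • (a * b + b * a) - b := by
    simp only [mul_sub, sub_mul, smul_mul_assoc, mul_smul_comm, one_mul, mul_one]
    module
  have e2 : (s • b - 1) * a * (s • b - 1) =
      s ^ 2 • (b * a * b) - s • (a * b + b * a) + a := by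
    simp only [mul_sub, sub_mul, smul_mul_assoc, mul_smul_comm, one_mul, mul_one]
    module
  rw [e1, e2, k1, k3, k4, k5]
  have f1 : (s * t ^ 2) • (t • a - 1) - (2 * s * t) • a + s • (1 : Matrix (Fin 2) (Fin 2) ℂ)
        - t ^ 2 • (r • a + b - s • (1 : Matrix (Fin 2) (Fin 2) ℂ))
        + t • (t • b + s • a + (r - t * s) • (1 : Matrix (Fin 2) (Fin 2) ℂ)) - b =
      (s * (t ^ 3 - t) - t ^ 2 * r) • a - b +
        (s * (1 - t ^ 2) + t * r) • (1 : Matrix (Fin 2) (Fin 2) ℂ) := by module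
  have f2 : s ^ 2 • (r • b + a - t • (1 : Matrix (Fin 2) (Fin 2) ℂ))
        - s • (t • b + s • a + (r - t * s) • (1 : Matrix (Fin 2) (Fin 2) ℂ)) + a =
      a + (s ^ 2 * r - s * t) • b + (-(s * r)) • (1 : Matrix (Fin 2) (Fin 2) ℂ) := by module
  rw [f1, f2, q1, q2, q3]
  module

theorem tr_inv_mul_sq (A B : SU11) :
    tr (A⁻¹ * B ^ 2) = tr A * tr B ^ 2 - tr B * tr (A * B) - tr A := by
  have k2 := sq_toMatrix B
  have : toMatrix (A⁻¹ * B ^ 2) = (tr A * tr B) • toMatrix B - tr A • 1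
      - tr B • toMatrix (A * B) + toMatrix A := by
    simp only [toMatrix_mul, pow_two, toMatrix_inv]
    rw [k2]
    simp only [mul_sub, sub_mul, smul_mul_assoc, mul_smul_comm, one_mul, mul_one]
    module
  rw [tr, this]
  simp only [Matrix.trace_add, Matrix.trace_sub, Matrix.trace_smul, Matrix.trace_one,
    Fintype.card_fin, smul_eq_mul]
  rw [← tr, ← tr, ← tr]
  push_cast
  ring

/-- Since sin ψ ≠ 0, the diagonal element has distinct eigenvalues and preserves only the coordinate
axes among lines; r ≠ 0 makes the other element move both. -/
theorem isIrreducibleRep_of_polar {G : Type*} [Group G] {ρ : G →* SU11} {g h : G} {ψ φ r : ℝ}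
    (hg : ρ g = polar ψ 0) (hh : ρ h = polar φ r) (hψ : Real.sin ψ ≠ 0) (hr : r ≠ 0) :
    IsIrreducibleRep ρ := by
  set e := Complex.exp (ψ * Complex.I) with he
  set e' := Complex.exp (-(ψ * Complex.I)) with he'
  have hee : e - e' ≠ 0 := by
    have : e - e' = 2 * Complex.I * ((Real.sin ψ : ℝ) : ℂ) := by
      rw [he, he', Complex.ofReal_sin, Complex.sin, neg_mul]
      linear_combination (Complex.exp (ψ * Complex.I) - Complex.exp (-(ψ * Complex.I))) *
        Complex.I_sq
    rw [this]
    exact mul_ne_zero (by simp) (by exact_mod_cast hψ)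
  have ag : ∀ v : Fin 2 → ℂ, linearRep ρ g v = ![e * v 0, e' * v 1] := by
    intro v
    change (toMatrix (ρ g)).mulVec v = _
    rw [hg, toMatrix_polar]
    ext i; fin_cases i <;> simp [he, he', Matrix.mulVec, dotProduct, Fin.sum_univ_two]
  have ah : ∀ v : Fin 2 → ℂ, linearRep ρ h v =
      ![Real.sqrt (1 + r ^ 2) * Complex.exp (φ * Complex.I) * v 0 + r * v 1,
        r * v 0 + Real.sqrt (1 + r ^ 2) * Complex.exp (-(φ * Complex.I)) * v 1] := by
    intro v
    change (toMatrix (ρ h)).mulVec v = _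
    rw [hh, toMatrix_polar]
    ext i; fin_cases i <;> simp [Matrix.mulVec, dotProduct, Fin.sum_univ_two]
  refine { exists_pair_ne := ⟨⊥, ⊤, fun hbt => ?_⟩, eq_bot_or_eq_top := fun W => ?_ }
  · have h2 : (⊥ : Submodule ℂ (Fin 2 → ℂ)) = ⊤ := congrArg Subrepresentation.toSubmodule hbt
    exact bot_ne_top h2
  by_cases hW : W.toSubmodule = ⊥
  · exact Or.inl (Subrepresentation.toSubmodule_injective hW)
  right
  apply Subrepresentation.toSubmodule_injective
  change W.toSubmodule = ⊤
  obtain ⟨v, hv, hv0⟩ := W.toSubmodule.ne_bot_iff.1 hW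
  have p0 : ∀ v ∈ W.toSubmodule, v 0 ≠ 0 → (![1, 0] : Fin 2 → ℂ) ∈ W.toSubmodule := by
    intro v hv hv0
    -- ρ(g) - e' annihilates the second coordinate, so it projects onto the first axis up to a
    -- scalar.
    have := W.toSubmodule.smul_mem (((e - e') * v 0)⁻¹)
      (W.toSubmodule.sub_mem (W.apply_mem_toSubmodule g hv) (W.toSubmodule.smul_mem e' hv))
    rw [ag] at this
    convert this using 1
    ext i
    fin_cases i
    · change 1 = ((e - e') * v 0)⁻¹ * (e * v 0 - e' * v 0)
      field_simp
    · change 0 = ((e - e') * v 0)⁻¹ * (e' * v 1 - e' * v 1)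
      ring
  have p1 : ∀ v ∈ W.toSubmodule, v 1 ≠ 0 → (![0, 1] : Fin 2 → ℂ) ∈ W.toSubmodule := by
    intro v hv hv0
    have := W.toSubmodule.smul_mem (((e' - e) * v 1)⁻¹)
      (W.toSubmodule.sub_mem (W.apply_mem_toSubmodule g hv) (W.toSubmodule.smul_mem e hv))
    rw [ag] at this
    have hee' : e' - e ≠ 0 := by rw [← neg_sub]; exact neg_ne_zero.2 hee
    convert this using 1
    ext i
    fin_cases i
    · change 0 = ((e' - e) * v 1)⁻¹ * (e * v 0 - e * v 0)
      ring
    · change 1 = ((e' - e) * v 1)⁻¹ * (e' * v 1 - e * v 1)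
      field_simp
  have both : (![1, 0] : Fin 2 → ℂ) ∈ W.toSubmodule ∧ (![0, 1] : Fin 2 → ℂ) ∈ W.toSubmodule := by
    by_cases h0 : v 0 = 0
    · have h1 : v 1 ≠ 0 := by
        intro h1; apply hv0; ext i; fin_cases i <;> simp [h0, h1]
      have m1 := p1 v hv h1
      refine ⟨p0 _ (W.apply_mem_toSubmodule h m1) ?_, m1⟩
      rw [ah]; simpa using hr
    · have m0 := p0 v hv h0
      refine ⟨m0, p1 _ (W.apply_mem_toSubmodule h m0) ?_⟩
      rw [ah]; simpa using hr
  rw [eq_top_iff]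
  intro w _
  have := W.toSubmodule.add_mem (W.toSubmodule.smul_mem (w 0) both.1)
    (W.toSubmodule.smul_mem (w 1) both.2)
  convert this using 1
  ext i; fin_cases i <;> simp

theorem not_isIrreducibleRep_of_upperTriangular {G : Type*} [Group G] {ρ : G →* SU11}
    (h : ∀ g, toMatrix (ρ g) 1 0 = 0) : ¬ IsIrreducibleRep ρ := by
  intro hirr
  let W : Subrepresentation (linearRep ρ) :=
    { toSubmodule := LinearMap.ker (LinearMap.proj (R := ℂ) (φ := fun _ : Fin 2 => ℂ) 1)
      apply_mem_toSubmodule := by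
        intro g v hv
        have hv1 : v 1 = 0 := hv
        change (toMatrix (ρ g)).mulVec v 1 = 0
        simp [Matrix.mulVec, dotProduct, Fin.sum_univ_two, h g, hv1] }
  have : IsSimpleOrder (Subrepresentation (linearRep ρ)) := hirr
  rcases eq_bot_or_eq_top W with hW | hW
  · have hm : (![1, 0] : Fin 2 → ℂ) ∈ W.toSubmodule := by
      change (![1, 0] : Fin 2 → ℂ) 1 = 0
      simp
    rw [hW] at hm
    have h2 : (![1, 0] : Fin 2 → ℂ) = 0 := hm
    simpa using congrFun h2 0
  · have hm : (![0, 1] : Fin 2 → ℂ) ∈ W.toSubmodule := by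
      rw [hW]; exact Submodule.mem_top
    have h2 : (![0, 1] : Fin 2 → ℂ) 1 = 0 := hm
    simp at h2

end SU11

/-! ### Representations of the pretzel knot group -/

theorem pretzel_induction {p : pretzel.KnotGroup → Prop} (hA : p pretzelA) (hB : p pretzelB)
    (one : p 1) (mul : ∀ g h, p g → p h → p (g * h)) (inv : ∀ g, p g → p g⁻¹) (g) : p g := by
  obtain ⟨g, rfl⟩ := pretzelEquiv.surjective g
  have hg : g ∈ Subgroup.closure (Set.range (PresentedGroup.of (rels := {pretzelRelator}))) := by
    rw [PresentedGroup.closure_range_of]; trivial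
  induction hg using Subgroup.closure_induction with
  | mem x hx =>
    obtain ⟨i, rfl⟩ := hx
    fin_cases i
    exacts [hA, hB]
  | one => rwa [map_one]
  | mul x y _ _ hx hy => rw [map_mul]; exact mul _ _ hx hy
  | inv x _ hx => rw [map_inv]; exact inv _ hx

theorem pretzel_hom_ext {H : Type*} [Group H] {f f' : pretzel.KnotGroup →* H}
    (hA : f pretzelA = f' pretzelA) (hB : f pretzelB = f' pretzelB) : f = f' := by
  refine MonoidHom.ext fun g => ?_
  refine pretzel_induction (p := fun g => f g = f' g) hA hB (by simp) ?_ ?_ g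
  · intro g h hg hh; rw [map_mul, map_mul, hg, hh]
  · intro g hg; rw [map_inv, map_inv, hg]

/-- The homomorphism out of the knot group with prescribed values on `a` and `b`. -/
def pretzelLift {H : Type*} [Group H] (A B : H) (h : A ^ 2 * B⁻¹ * A ^ 2 = B ^ 2 * A * B ^ 2) :
    pretzel.KnotGroup →* H :=
  (PresentedGroup.toGroup (rels := {pretzelRelator}) (f := ![A, B]) (by
    rintro _ rfl
    simp only [pretzelRelator, map_mul, map_pow, map_inv, FreeGroup.lift_apply_of,
      Matrix.cons_val_zero, Matrix.cons_val_one]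
    rw [h, mul_inv_cancel])).comp pretzelEquiv.symm.toMonoidHom

theorem pretzelLift_pretzelA {H : Type*} [Group H] (A B : H)
    (h : A ^ 2 * B⁻¹ * A ^ 2 = B ^ 2 * A * B ^ 2) : pretzelLift A B h pretzelA = A := by
  rw [pretzelLift, pretzelA, MonoidHom.comp_apply, MulEquiv.toMonoidHom_eq_coe,
    MonoidHom.coe_coe, MulEquiv.symm_apply_apply, PresentedGroup.toGroup.of]
  rfl

theorem pretzelLift_pretzelB {H : Type*} [Group H] (A B : H)
    (h : A ^ 2 * B⁻¹ * A ^ 2 = B ^ 2 * A * B ^ 2) : pretzelLift A B h pretzelB = B := by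
  rw [pretzelLift, pretzelB, MonoidHom.comp_apply, MulEquiv.toMonoidHom_eq_coe,
    MonoidHom.coe_coe, MulEquiv.symm_apply_apply, PresentedGroup.toGroup.of]
  rfl

theorem pretzel_relation :
    pretzelA ^ 2 * pretzelB⁻¹ * pretzelA ^ 2 = pretzelB ^ 2 * pretzelA * pretzelB ^ 2 := by
  have := congrArg pretzelEquiv (pretzelPresentation_relation rfl rfl)
  simpa only [map_mul, map_pow, map_inv, pretzelA, pretzelB] using this

/-- The relator gives two forms of σ: abab² and a⁻¹b²aba². Multiplying the first by μ on the left
and the second by μ on the right yields the same word. -/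
theorem pretzel_commute_meridian_longitude : Commute pretzel.meridian pretzel.longitude := by
  obtain ⟨hm, hl⟩ := pretzel_peripheral
  rw [hl, ← hm]
  refine ((Commute.refl _).zpow_right _).mul_right ?_
  have hr := pretzel_relation
  rw [hm]
  generalize pretzelA = a, pretzelB = b at *
  have s1 : a * b⁻¹ * a ^ 2 * b⁻¹ * a ^ 2 = a * b * a * b ^ 2 := by
    calc _ = a * b⁻¹ * (a ^ 2 * b⁻¹ * a ^ 2) := by simp only [mul_assoc]
      _ = _ := by rw [hr]; simp [pow_succ, mul_assoc]
  have s2 : a * b⁻¹ * a ^ 2 * b⁻¹ * a ^ 2 = a⁻¹ * b ^ 2 * a * b * a ^ 2 := by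
    calc _ = a⁻¹ * (a ^ 2 * b⁻¹ * a ^ 2) * b⁻¹ * a ^ 2 := by simp [pow_succ, mul_assoc]
      _ = _ := by rw [hr]; simp [pow_succ, mul_assoc]
  change _ * _ = _ * _
  conv_lhs => rw [s1]
  conv_rhs => rw [s2]
  simp [pow_succ, mul_assoc]

/-- The meridian commutes with the whole peripheral subgroup, so its ellipticity controls every
peripheral element. -/
theorem pretzel_isEllipticRep {ρ : pretzel.KnotGroup →* SU11}
    (h : SU11.IsElliptic (ρ (pretzelA⁻¹ * pretzelB ^ 2))) : pretzel.IsEllipticRep ρ := by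
  rw [← pretzel_peripheral.1] at h
  refine ⟨⟨pretzel.meridian, Subgroup.subset_closure (by simp), ?_⟩, fun g hg => ?_⟩
  · unfold SU11.IsElliptic SU11.tr at h
    rintro (hc | hc) <;> rw [hc] at h <;> norm_num at h
  · refine SU11.isCentral_or_isElliptic_of_commute h (Commute.map ?_ ρ)
    have : pretzel.peripheral ≤ Subgroup.centralizer {pretzel.meridian} := by
      rw [KnotDiagram.peripheral, Subgroup.closure_le]
      rintro x (rfl | rfl)
      · exact Subgroup.mem_centralizer_singleton_iff.2 rfl
      · exact Subgroup.mem_centralizer_singleton_iff.2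
          pretzel_commute_meridian_longitude.symm.eq
    exact (Subgroup.mem_centralizer_singleton_iff.1 (this hg)).symm

/-- The word for a in Wirtinger generators has exponent sum 5; that for b has exponent sum 3. -/
theorem pretzel_abelianRep_pretzelA (z : Circle) :
    pretzel.abelianRep z pretzelA = SU11.diag (z ^ 5) := by
  have hof : ∀ k, pretzel.abelianRep z (pretzel.arc k) = SU11.diag z := fun k =>
    PresentedGroup.toGroup.of _
  rw [show pretzelA = _ from pretzelHom_of.1]
  simp only [map_mul, map_pow, hof]
  rw [← SU11.diag_pow]
  simp [pow_succ, mul_assoc]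

theorem pretzel_abelianRep_pretzelB (z : Circle) :
    pretzel.abelianRep z pretzelB = SU11.diag (z ^ 3) := by
  have hof : ∀ k, pretzel.abelianRep z (pretzel.arc k) = SU11.diag z := fun k =>
    PresentedGroup.toGroup.of _
  rw [show pretzelB = _ from pretzelHom_of.2]
  simp only [map_mul, map_inv, map_pow, hof]
  rw [← SU11.diag_pow]
  simp [pow_succ, mul_assoc]

theorem pretzel_abelianRep_not_isIrreducibleRep (z : Circle) :
    ¬ SU11.IsIrreducibleRep (pretzel.abelianRep z) := by
  refine SU11.not_isIrreducibleRep_of_upperTriangular fun g => ?_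
  induction g using pretzel_induction with
  | hA => rw [pretzel_abelianRep_pretzelA]; rfl
  | hB => rw [pretzel_abelianRep_pretzelB]; rfl
  | one => rw [map_one, SU11.toMatrix_one]; simp
  | mul g h hg hh =>
    rw [map_mul, SU11.toMatrix_mul, Matrix.mul_apply, Fin.sum_univ_two, hg, hh]; simp
  | inv g hg => rw [map_inv, SU11.toMatrix_inv]; simp [hg]

theorem pretzel_continuousOn {ρ : ℝ → pretzel.KnotGroup →* SU11} {S : Set ℝ}
    (hA : ContinuousOn (fun t => ρ t pretzelA) S) (hB : ContinuousOn (fun t => ρ t pretzelB) S)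
    (g : pretzel.KnotGroup) : ContinuousOn (fun t => ρ t g) S := by
  induction g using pretzel_induction with
  | hA => exact hA
  | hB => exact hB
  | one => simp only [map_one]; exact continuousOn_const
  | mul g h hg hh => simp only [map_mul]; exact hg.mul hh
  | inv g hg => simp only [map_inv]; exact hg.inv

/-! ### The trace curve -/

/-- The argument `α` of the diagonal matrix `ρ(t)(a)`. -/
def curveAlpha (t : ℝ) : ℝ := 2 * Real.pi - Real.arccos (t / 2)

/-- The tangent of the argument `β` of `ρ(t)(b)`. -/
def curveTan (t : ℝ) : ℝ :=
  1 / Real.sin (curveAlpha t) * (t / 2 - (1 - 1 / t ^ 2) / (t / (t ^ 2 - 1)))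

/-- The argument `β` of the diagonal of `ρ(t)(b)`. -/
def curveBeta (t : ℝ) : ℝ := Real.pi + Real.arctan (curveTan t)

/-- The off-diagonal entry `R` of `ρ(t)(b)`. -/
def curveR (t : ℝ) : ℝ :=
  Real.sqrt ((t / (t ^ 2 - 1) / (2 * Real.cos (curveBeta t))) ^ 2 - 1)

/-- An interval of parameters `t` that contains the one of interest. -/
def curveDomain : Set ℝ := {t | 0 < t ∧ 0.605 ≤ t ^ 2 ∧ t ^ 2 ≤ 0.645}

/-- The polynomial in `t²` that has the sign of `R²`. -/
def curvePoly (u : ℝ) : ℝ := u ^ 5 - 6 * u ^ 4 + 8 * u ^ 3 + u ^ 2 - 4 * u + 1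

/-- This makes R² positive as soon as t leaves t₀, where it vanishes. The divided difference is
positive by termwise bounds. -/
theorem curvePoly_strictMonoOn : StrictMonoOn curvePoly (Set.Icc 0.605 0.645) := by
  rintro u ⟨hu, hu'⟩ v ⟨hv, hv'⟩ huv
  have e : curvePoly v - curvePoly u = (v - u) *
      ((v ^ 4 + v ^ 3 * u + v ^ 2 * u ^ 2 + v * u ^ 3 + u ^ 4)
        - 6 * (v ^ 3 + v ^ 2 * u + v * u ^ 2 + u ^ 3)
        + 8 * (v ^ 2 + v * u + u ^ 2) + (v + u) - 4) := by
    unfold curvePoly; ring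
  have lo : ∀ x y : ℝ, 0.605 ≤ x → x ≤ 0.645 → 0.605 ≤ y → y ≤ 0.645 → 0.366 ≤ x * y ∧
      x * y ≤ 0.41603 := by
    intro x y h1 h2 h3 h4; constructor <;> nlinarith
  have a1 := lo v v hv hv' hv hv'
  have a2 := lo v u hv hv' hu hu'
  have a3 := lo u u hu hu' hu hu'
  have b1 : v ^ 3 ≤ 0.2684 := by nlinarith
  have b2 : v ^ 2 * u ≤ 0.2684 := by nlinarith
  have b3 : v * u ^ 2 ≤ 0.2684 := by nlinarith
  have b4 : u ^ 3 ≤ 0.2684 := by nlinarith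
  have c1 : 0.1339 ≤ v ^ 4 := by nlinarith
  have c2 : 0.1339 ≤ v ^ 3 * u := by nlinarith
  have c3 : 0.1339 ≤ v ^ 2 * u ^ 2 := by nlinarith
  have c4 : 0.1339 ≤ v * u ^ 3 := by nlinarith
  have c5 : 0.1339 ≤ u ^ 4 := by nlinarith
  have := mul_pos (sub_pos.2 huv) (show 0 <
      ((v ^ 4 + v ^ 3 * u + v ^ 2 * u ^ 2 + v * u ^ 3 + u ^ 4)
        - 6 * (v ^ 3 + v ^ 2 * u + v * u ^ 2 + u ^ 3)
        + 8 * (v ^ 2 + v * u + u ^ 2) + (v + u) - 4) by nlinarith)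
  linarith

section curve

variable {t : ℝ}

theorem curveDomain_lt (ht : t ∈ curveDomain) : t < 0.81 := by
  obtain ⟨h0, -, h2⟩ := ht; nlinarith

theorem curveDomain_gt (ht : t ∈ curveDomain) : 0.77 < t := by
  obtain ⟨h0, h1, -⟩ := ht; nlinarith

theorem cos_curveAlpha (ht : t ∈ curveDomain) : Real.cos (curveAlpha t) = t / 2 := by
  rw [curveAlpha, Real.cos_two_pi_sub,
    Real.cos_arccos (by linarith [ht.1]) (by linarith [curveDomain_lt ht])]

theorem sin_curveAlpha : Real.sin (curveAlpha t) = -Real.sqrt (1 - (t / 2) ^ 2) := by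
  rw [curveAlpha, Real.sin_two_pi_sub, Real.sin_arccos]

theorem sin_curveAlpha_neg (ht : t ∈ curveDomain) : Real.sin (curveAlpha t) < 0 := by
  rw [sin_curveAlpha, neg_lt_zero]
  exact Real.sqrt_pos.2 (by nlinarith [ht.2.2])

theorem curveAlpha_mem (ht : t ∈ curveDomain) :
    curveAlpha t ∈ Set.Ioo (3 * Real.pi / 2) (2 * Real.pi) := by
  have h1 : Real.arccos (t / 2) < Real.pi / 2 :=
    Real.arccos_lt_pi_div_two.2 (by linarith [ht.1])
  have h2 : 0 < Real.arccos (t / 2) := Real.arccos_pos.2 (by linarith [curveDomain_lt ht])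
  constructor <;> rw [curveAlpha] <;> linarith

/-- Negativity puts β = π + arctan in the second quadrant. Here sin α < 0, while the other factor is
positive because t⁴ > 2(t²-1)² on the domain. -/
theorem curveTan_neg (ht : t ∈ curveDomain) : curveTan t < 0 := by
  have hs := sin_curveAlpha_neg ht
  have h0 := ht.1
  have h1 : t ^ 2 - 1 ≠ 0 := by linarith [ht.2.2]
  refine mul_neg_of_neg_of_pos (one_div_neg.2 hs) ?_
  have : t / 2 - (1 - 1 / t ^ 2) / (t / (t ^ 2 - 1)) =
      (t ^ 4 - 2 * (t ^ 2 - 1) ^ 2) / (2 * t ^ 3) := by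
    field_simp
  rw [this]
  have := ht.2.1
  have := ht.2.2
  exact div_pos (by nlinarith) (by positivity)

theorem curveBeta_mem (ht : t ∈ curveDomain) :
    curveBeta t ∈ Set.Ioo (Real.pi / 2) Real.pi := by
  have h1 := Real.neg_pi_div_two_lt_arctan (curveTan t)
  have h2 : Real.arctan (curveTan t) < 0 := Real.arctan_lt_zero.2 (curveTan_neg ht)
  constructor <;> rw [curveBeta] <;> linarith

theorem tan_curveBeta : Real.tan (curveBeta t) = curveTan t := by
  rw [curveBeta, add_comm, Real.tan_add_pi, Real.tan_arctan]

theorem cos_curveBeta : Real.cos (curveBeta t) = -(1 / Real.sqrt (1 + curveTan t ^ 2)) := by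
  rw [curveBeta, add_comm, Real.cos_add_pi, Real.cos_arctan]

theorem cos_curveBeta_neg : Real.cos (curveBeta t) < 0 := by
  rw [cos_curveBeta, neg_lt_zero]; positivity

/-- Substitute 1/cos² β = 1 + tan² β and sin² α = (4-t²)/4, then clear denominators. -/
theorem curve_radius (ht : t ∈ curveDomain) :
    (t / (t ^ 2 - 1) / (2 * Real.cos (curveBeta t))) ^ 2 - 1 =
      curvePoly (t ^ 2) / (t ^ 4 * (t ^ 2 - 1) ^ 2 * (4 - t ^ 2)) := by
  have h0 := ht.1.ne'
  have h1 : t ^ 2 - 1 ≠ 0 := by linarith [ht.2.2]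
  have h4 : 4 - t ^ 2 ≠ 0 := by linarith [ht.2.2]
  have hsin : Real.sin (curveAlpha t) ^ 2 = (4 - t ^ 2) / 4 := by
    rw [Real.sin_sq, cos_curveAlpha ht]; ring
  have hT : curveTan t ^ 2 = 4 / (4 - t ^ 2) * (t / 2 - (t ^ 2 - 1) ^ 2 / t ^ 3) ^ 2 := by
    rw [curveTan, mul_pow, div_pow, hsin]
    field_simp
  have hc : Real.cos (curveBeta t) ^ 2 = (1 + curveTan t ^ 2)⁻¹ := by
    rw [cos_curveBeta, neg_sq, div_pow, Real.sq_sqrt (by positivity), one_pow, one_div]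
  have : (t / (t ^ 2 - 1) / (2 * Real.cos (curveBeta t))) ^ 2 =
      (t / (t ^ 2 - 1)) ^ 2 / 4 * (1 + curveTan t ^ 2) := by
    rw [div_pow, mul_pow, hc]
    field_simp
    norm_num
  rw [this, hT, curvePoly]
  field_simp
  ring

theorem curve_denominator_pos (ht : t ∈ curveDomain) :
    0 < t ^ 4 * (t ^ 2 - 1) ^ 2 * (4 - t ^ 2) := by
  have h0 := ht.1
  have h1 : t ^ 2 - 1 ≠ 0 := by linarith [ht.2.2]
  have h4 : 0 < 4 - t ^ 2 := by linarith [ht.2.2]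
  positivity

theorem curveR_sq (ht : t ∈ curveDomain) (hp : 0 ≤ curvePoly (t ^ 2)) :
    curveR t ^ 2 = (t / (t ^ 2 - 1) / (2 * Real.cos (curveBeta t))) ^ 2 - 1 :=
  Real.sq_sqrt (by rw [curve_radius ht]; exact div_nonneg hp (curve_denominator_pos ht).le)

theorem curveR_pos (ht : t ∈ curveDomain) (hp : 0 < curvePoly (t ^ 2)) : 0 < curveR t :=
  Real.sqrt_pos.2 (by rw [curve_radius ht]; exact div_pos hp (curve_denominator_pos ht))

/-- The quotient s/(2cos β) is positive, since s and cos β are both negative, so the square root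
returns it without a sign change. -/
theorem sqrt_one_add_curveR_sq (ht : t ∈ curveDomain) (hp : 0 ≤ curvePoly (t ^ 2)) :
    2 * Real.sqrt (1 + curveR t ^ 2) * Real.cos (curveBeta t) = t / (t ^ 2 - 1) := by
  have hc := cos_curveBeta_neg (t := t)
  have hs : t / (t ^ 2 - 1) < 0 := div_neg_of_pos_of_neg ht.1 (by linarith [ht.2.2])
  rw [curveR_sq ht hp, add_sub_cancel, Real.sqrt_sq (div_pos_of_neg_of_neg hs (by linarith)).le]
  have := hc.ne
  field_simp

theorem tr_curve_a (ht : t ∈ curveDomain) : SU11.tr (SU11.polar (curveAlpha t) 0) = t := by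
  rw [SU11.tr_polar, cos_curveAlpha ht]
  congr 1
  norm_num
  ring

theorem tr_curve_b (ht : t ∈ curveDomain) (hp : 0 ≤ curvePoly (t ^ 2)) :
    SU11.tr (SU11.polar (curveBeta t) (curveR t)) = ((t / (t ^ 2 - 1) : ℝ) : ℂ) := by
  rw [SU11.tr_polar, sqrt_one_add_curveR_sq ht hp]

/-- The trace of the product is s(cos α - sin α tan β); setting it equal to r and solving for tan β
gives exactly `curveTan`. -/
theorem tr_curve_ab (ht : t ∈ curveDomain) (hp : 0 ≤ curvePoly (t ^ 2)) :
    SU11.tr (SU11.polar (curveAlpha t) 0 * SU11.polar (curveBeta t) (curveR t)) =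
      ((1 - 1 / t ^ 2 : ℝ) : ℂ) := by
  rw [SU11.tr_polar_zero_mul]
  congr 1
  have hc := (cos_curveBeta_neg (t := t)).ne
  have hs := (sin_curveAlpha_neg ht).ne
  have h0 := ht.1.ne'
  have h1 : t ^ 2 - 1 ≠ 0 := by linarith [ht.2.2]
  have hadd : Real.cos (curveAlpha t + curveBeta t) = Real.cos (curveBeta t) *
      (Real.cos (curveAlpha t) - Real.sin (curveAlpha t) * Real.tan (curveBeta t)) := by
    rw [Real.cos_add, Real.tan_eq_sin_div_cos]; field_simp
  rw [hadd, ← mul_assoc, sqrt_one_add_curveR_sq ht hp, cos_curveAlpha ht, tan_curveBeta, curveTan]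
  field_simp
  ring

theorem curve_relation (ht : t ∈ curveDomain) (hp : 0 ≤ curvePoly (t ^ 2)) :
    SU11.polar (curveAlpha t) 0 ^ 2 * (SU11.polar (curveBeta t) (curveR t))⁻¹ *
        SU11.polar (curveAlpha t) 0 ^ 2 =
      SU11.polar (curveBeta t) (curveR t) ^ 2 * SU11.polar (curveAlpha t) 0 *
        SU11.polar (curveBeta t) (curveR t) ^ 2 := by
  have h0 := ht.1.ne'
  have h1 : t ^ 2 - 1 ≠ 0 := by linarith [ht.2.2]
  refine SU11.pretzel_relation_of_traces (t := t) (by exact_mod_cast h0) (by exact_mod_cast h1)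
    (tr_curve_a ht) ?_ ?_
  · rw [tr_curve_b ht hp]; push_cast; rfl
  · rw [tr_curve_ab ht hp]; push_cast; rfl

theorem continuous_curveAlpha : Continuous curveAlpha := by
  unfold curveAlpha; fun_prop

theorem continuousOn_curveTan : ContinuousOn curveTan curveDomain := by
  have h1 : ∀ t ∈ curveDomain, Real.sin (curveAlpha t) ≠ 0 := fun t ht => (sin_curveAlpha_neg ht).ne
  have h2 : ∀ t ∈ curveDomain, t ^ 2 ≠ 0 := fun t ht => by linarith [ht.2.1]
  have h3 : ∀ t ∈ curveDomain, t ^ 2 - 1 ≠ 0 := fun t ht => by linarith [ht.2.2]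
  have h4 : ∀ t ∈ curveDomain, t / (t ^ 2 - 1) ≠ 0 := fun t ht => div_ne_zero ht.1.ne' (h3 t ht)
  have h5 := continuous_curveAlpha
  unfold curveTan
  fun_prop (disch := assumption)

theorem continuousOn_curveBeta : ContinuousOn curveBeta curveDomain :=
  continuousOn_const.add (Real.continuous_arctan.comp_continuousOn continuousOn_curveTan)

theorem continuousOn_curveR : ContinuousOn curveR curveDomain := by
  have h1 : ∀ t ∈ curveDomain, 2 * Real.cos (curveBeta t) ≠ 0 := fun t _ =>
    mul_ne_zero two_ne_zero cos_curveBeta_neg.ne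
  have h3 : ∀ t ∈ curveDomain, t ^ 2 - 1 ≠ 0 := fun t ht => by linarith [ht.2.2]
  have h5 := continuousOn_curveBeta
  unfold curveR
  fun_prop (disch := assumption)

/-- The trace of the meridian stays in `(-2, 2)` up to the root of `t³ + 2t² - t - 1`. -/
theorem curve_isElliptic_meridian (ht : t ∈ curveDomain) (hp : 0 ≤ curvePoly (t ^ 2))
    (h : t ^ 3 + 2 * t ^ 2 - t - 1 < 0) :
    SU11.IsElliptic ((SU11.polar (curveAlpha t) 0)⁻¹ *
      SU11.polar (curveBeta t) (curveR t) ^ 2) := by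
  have h0 := ht.1
  have hlt := curveDomain_lt ht
  have hgt := curveDomain_gt ht
  have h1 : t ^ 2 - 1 ≠ 0 := by linarith [ht.2.2]
  have e : t * (t / (t ^ 2 - 1)) ^ 2 - t / (t ^ 2 - 1) * (1 - 1 / t ^ 2) - t =
      (t ^ 4 - (t ^ 2 + 1) * (t ^ 2 - 1) ^ 2) / (t * (t ^ 2 - 1) ^ 2) := by
    field_simp
    ring
  rw [SU11.IsElliptic, SU11.tr_inv_mul_sq, tr_curve_a ht, tr_curve_b ht hp, tr_curve_ab ht hp]
  have hd : 0 < t * (t ^ 2 - 1) ^ 2 := by positivity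
  rw [← Complex.ofReal_pow, ← Complex.ofReal_mul, ← Complex.ofReal_mul, ← Complex.ofReal_sub,
    ← Complex.ofReal_sub, Complex.norm_real, Real.norm_eq_abs, e, abs_lt, lt_div_iff₀ hd,
    div_lt_iff₀ hd]
  -- The numerators of trace + 2 and trace - 2 are differences of squares, t⁴ - (1∓t)²(1-t²)². Their
  -- four factors are p1, …, p4, and only p4, the cubic t³ + 2t² - t - 1, can change sign here.
  have p1 : 0 < t ^ 2 - (1 - t) * (1 - t ^ 2) := by nlinarith [ht.2.1, ht.2.2]
  have p2 : 0 < t ^ 2 + (1 - t) * (1 - t ^ 2) := by nlinarith [ht.2.1, ht.2.2]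
  have p3 : 0 < t ^ 2 + (1 + t) * (1 - t ^ 2) := by nlinarith [ht.2.1, ht.2.2]
  have p4 : t ^ 2 - (1 + t) * (1 - t ^ 2) < 0 := by linarith
  constructor
  · linarith [mul_pos p1 p2]
  · linarith [mul_neg_of_neg_of_pos p4 p3]

end curve

/-! ### The abelian endpoint -/

/-- The abelian traces lie on the curve, so α and β are determined by them once the branches are
checked; then s = 2cos β, which is R = 0. -/
theorem curve_endpoint {θ t : ℝ} (hθ : |θ - 2.0453| ≤ 0.00005)
    (h : alexanderTrace (2 * Real.cos θ) = 0) (ht : t = 2 * Real.cos (5 * θ / 2))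
    (hd : t ∈ curveDomain) :
    curveAlpha t = 5 * θ / 2 ∧ curveBeta t = 3 * θ / 2 ∧ curveR t = 0 ∧
      curvePoly (t ^ 2) = 0 := by
  rw [abs_le] at hθ
  have hpi := Real.pi_gt_d2
  have hpi' := Real.pi_lt_d2
  obtain ⟨e3, e4, -⟩ := abelian_traces h ht
  have h0 := hd.1.ne'
  have h1 : t ^ 2 - 1 ≠ 0 := by linarith [hd.2.2]
  have ha : curveAlpha t = 5 * θ / 2 := by
    -- Branch choice: 2π - 5θ/2 ≈ 1.17 lies in the range of arccos.
    rw [curveAlpha, ht, mul_div_cancel_left₀ _ two_ne_zero, ← Real.cos_two_pi_sub,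
      Real.arccos_cos (by linarith) (by linarith)]
    ring
  have hs : t / (t ^ 2 - 1) = 2 * Real.cos (3 * θ / 2) := by
    rw [div_eq_iff h1]; exact e3.symm
  have hr : 1 - 1 / t ^ 2 = 2 * Real.cos (4 * θ) := by
    field_simp; linarith
  have hsin := (sin_curveAlpha_neg hd).ne
  have hcos : Real.cos (3 * θ / 2) ≠ 0 := by
    intro hc; rw [hc] at e3; apply h0; linarith
  have hT : curveTan t = Real.tan (3 * θ / 2) := by
    rw [curveTan, hs, hr, ← cos_curveAlpha hd, Real.tan_eq_sin_div_cos]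
    rw [ha] at hsin ⊢
    rw [show 4 * θ = 5 * θ / 2 + 3 * θ / 2 by ring, Real.cos_add]
    generalize 5 * θ / 2 = φ at hsin ⊢
    generalize 3 * θ / 2 = ψ at hcos ⊢
    field_simp
    ring
  have hb : curveBeta t = 3 * θ / 2 := by
    -- Branch choice: 3θ/2 - π ≈ -0.07 lies in the range of arctan.
    rw [curveBeta, hT, ← Real.tan_sub_pi, Real.arctan_tan (by linarith) (by linarith)]
    ring
  have hK : (t / (t ^ 2 - 1) / (2 * Real.cos (curveBeta t))) ^ 2 - 1 = 0 := by
    rw [hs, hb, div_self (mul_ne_zero two_ne_zero hcos)]; norm_num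
  refine ⟨ha, hb, by rw [curveR, hK, Real.sqrt_zero], ?_⟩
  rw [curve_radius hd] at hK
  exact (div_eq_zero_iff.1 hK).resolve_right (curve_denominator_pos hd).ne'

/-- The end of the path: the root of `t³ + 2t² - t - 1`, where the meridian becomes parabolic. -/
theorem exists_parabolic_endpoint :
    ∃ t : ℝ, 0.8 < t ∧ t < 0.802 ∧ t ^ 3 + 2 * t ^ 2 - t - 1 = 0 := by
  have hc : ContinuousOn (fun t : ℝ => t ^ 3 + 2 * t ^ 2 - t - 1) (Set.Icc 0.8 0.802) := by fun_prop
  obtain ⟨t, ht, h⟩ := intermediate_value_Ioo (by norm_num) hc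
    (show (0 : ℝ) ∈ Set.Ioo _ _ by constructor <;> norm_num)
  exact ⟨t, ht.1, ht.2, h⟩

open Classical in
/-- The path of representations over the trace curve. -/
def curveRep (t : ℝ) : pretzel.KnotGroup →* SU11 :=
  if h : SU11.polar (curveAlpha t) 0 ^ 2 * (SU11.polar (curveBeta t) (curveR t))⁻¹ *
        SU11.polar (curveAlpha t) 0 ^ 2 =
      SU11.polar (curveBeta t) (curveR t) ^ 2 * SU11.polar (curveAlpha t) 0 *
        SU11.polar (curveBeta t) (curveR t) ^ 2 then
    pretzelLift _ _ h
  -- A default value: the relation holds throughout [t₀, t₁), so this branch plays no role there.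
  else 1

theorem curveRep_apply {t : ℝ} (ht : t ∈ curveDomain) (hp : 0 ≤ curvePoly (t ^ 2)) :
    curveRep t pretzelA = SU11.polar (curveAlpha t) 0 ∧
      curveRep t pretzelB = SU11.polar (curveBeta t) (curveR t) := by
  rw [curveRep, dif_pos (curve_relation ht hp)]
  exact ⟨pretzelLift_pretzelA _ _ _, pretzelLift_pretzelB _ _ _⟩

end


/-! ### Assembling the path of representations -/

theorem theorem4p3 :
    ∃ θ₀ t₀ t₁ : ℝ,
      |θ₀ - 2.0453| ≤ 0.00005 ∧
      Polynomial.aeval (Complex.exp (θ₀ * Complex.I)) pretzel.alexanderPolynomial = 0 ∧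
      t₀ = 2 * Real.cos (5 * θ₀ / 2) ∧
      0 < t₀ ∧ t₀ < t₁ ∧ t₁ < 1 ∧
      t₁ ^ 3 / (t₁ ^ 2 - 1) ^ 2 - 1 / t₁ - t₁ = 2 ∧
      ∃ ρ : ℝ → (pretzel.KnotGroup →* SU11),
        (∀ g : pretzel.KnotGroup, ContinuousOn (fun t => ρ t g) (Set.Ico t₀ t₁)) ∧
        ρ t₀ = pretzel.abelianRep (Circle.exp (θ₀ / 2)) ∧
        (∀ t ∈ Set.Ico t₀ t₁,
          pretzel.IsEllipticRep (ρ t) ∧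
          (SU11.IsIrreducibleRep (ρ t) ↔ t ≠ t₀) ∧
          SU11.tr (ρ t pretzelA) = (t : ℂ) ∧
          SU11.tr (ρ t pretzelB) = ((t / (t ^ 2 - 1) : ℝ) : ℂ) ∧
          SU11.tr (ρ t (pretzelA * pretzelB)) = ((1 - 1 / t ^ 2 : ℝ) : ℂ)) ∧
        ∃ α β R : ℝ → ℝ,
          ContinuousOn α (Set.Ico t₀ t₁) ∧
          ContinuousOn β (Set.Ico t₀ t₁) ∧
          ContinuousOn R (Set.Ico t₀ t₁) ∧
          ∀ t ∈ Set.Ico t₀ t₁,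
            α t ∈ Set.Ioo (3 * Real.pi / 2) (2 * Real.pi) ∧
            β t ∈ Set.Ioo (Real.pi / 2) Real.pi ∧
            SU11.toMatrix (ρ t pretzelA) =
              !![Complex.exp (α t * Complex.I), 0;
                 0, Complex.exp (-(α t * Complex.I))] ∧
            SU11.toMatrix (ρ t pretzelB) =
              !![Real.sqrt (1 + R t ^ 2) * Complex.exp (β t * Complex.I), (R t : ℂ);
                 (R t : ℂ), Real.sqrt (1 + R t ^ 2) * Complex.exp (-(β t * Complex.I))] ∧
            Real.cos (α t) = t / 2 ∧
            Real.tan (β t) =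
              1 / Real.sin (α t) * (t / 2 - (1 - 1 / t ^ 2) / (t / (t ^ 2 - 1))) ∧
            R t ^ 2 = (t / (t ^ 2 - 1) / (2 * Real.cos (β t))) ^ 2 - 1 := by
  obtain ⟨θ, hθ, hy, hy', hroot⟩ := exists_alexanderTrace_root
  obtain ⟨t₁, ht₁, ht₁', hend⟩ := exists_parabolic_endpoint
  obtain ⟨t₀, ht₀⟩ : ∃ t₀, t₀ = 2 * Real.cos (5 * θ / 2) := ⟨_, rfl⟩
  have hθ' := abs_le.1 hθ
  have hpos : 0 < t₀ := by
    have hpi := Real.pi_gt_d2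
    have hpi' := Real.pi_lt_d2
    -- 5θ/2 - 2π ≈ -1.17 lies in (-π/2, π/2).
    rw [ht₀, ← Real.cos_sub_two_pi]
    exact mul_pos two_pos (Real.cos_pos_of_mem_Ioo ⟨by linarith, by linarith⟩)
  have hsq := (abelian_traces hroot ht₀).2.2
  -- In terms of y ≈ -0.914 one gets t₀² ≈ 0.609. The bound 0.611 is below 0.64 < t₁², which later
  -- gives t₀ < t₁.
  have hd₀ : t₀ ∈ curveDomain ∧ t₀ ^ 2 ≤ 0.611 := by
    set y := 2 * Real.cos θ
    have y1 : 0.748 ≤ y ^ 2 - y - 1 ∧ y ^ 2 - y - 1 ≤ 0.7495 := by constructor <;> nlinarith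
    have z1 : 0.5595 ≤ (y ^ 2 - y - 1) ^ 2 ∧ (y ^ 2 - y - 1) ^ 2 ≤ 0.5618 := by
      constructor <;> nlinarith [y1.1, y1.2]
    have : 0.605 ≤ t₀ ^ 2 ∧ t₀ ^ 2 ≤ 0.611 := by
      rw [hsq]; constructor <;> nlinarith [z1.1, z1.2]
    exact ⟨⟨hpos, by linarith, by linarith⟩, by linarith⟩
  obtain ⟨hα, hβ, hR, hp₀⟩ := curve_endpoint hθ hroot ht₀ hd₀.1
  have hdom : Set.Ico t₀ t₁ ⊆ curveDomain := fun t ht => by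
    refine ⟨hpos.trans_le ht.1, ?_, ?_⟩
    · exact hd₀.1.2.1.trans (pow_le_pow_left₀ hpos.le ht.1 2)
    · nlinarith [hpos.trans_le ht.1, ht.2]
  have hpp : ∀ t ∈ Set.Ico t₀ t₁, t ≠ t₀ → 0 < curvePoly (t ^ 2) := fun t ht hne => by
    rw [← hp₀]
    exact curvePoly_strictMonoOn hd₀.1.2 (hdom ht).2
      (pow_lt_pow_left₀ (lt_of_le_of_ne ht.1 hne.symm) hpos.le two_ne_zero)
  have hp : ∀ t ∈ Set.Ico t₀ t₁, 0 ≤ curvePoly (t ^ 2) := fun t ht => by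
    by_cases h : t = t₀
    · rw [h, hp₀]
    · exact (hpp t ht h).le
  have hlt : t₀ < t₁ := by nlinarith [hd₀.2]
  have hm₀ : t₀ ∈ Set.Ico t₀ t₁ := ⟨le_rfl, hlt⟩
  have habel : curveRep t₀ = pretzel.abelianRep (Circle.exp (θ / 2)) := by
    obtain ⟨hA, hB⟩ := curveRep_apply hd₀.1 (hp t₀ hm₀)
    refine pretzel_hom_ext ?_ ?_
    · rw [hA, hα, SU11.polar_zero, pretzel_abelianRep_pretzelA, ← Circle.exp_nsmul]
      congr 2
      rw [nsmul_eq_mul]; push_cast; ring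
    · rw [hB, hβ, hR, SU11.polar_zero, pretzel_abelianRep_pretzelB, ← Circle.exp_nsmul]
      congr 2
      rw [nsmul_eq_mul]; push_cast; ring
  have cα := continuous_curveAlpha.continuousOn (s := Set.Ico t₀ t₁)
  have cβ := continuousOn_curveBeta.mono hdom
  have cR := continuousOn_curveR.mono hdom
  refine ⟨θ, t₀, t₁, hθ, ?_, ht₀, hpos, hlt, by linarith, ?_, curveRep, ?_, habel, ?_,
    curveAlpha, curveBeta, curveR, cα, cβ, cR, ?_⟩
  · exact aeval_alexanderPolynomial_of_alexanderTrace (by linarith) hroot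
  · have h0 : t₁ ≠ 0 := by linarith
    have h1 : t₁ ^ 2 - 1 ≠ 0 := by nlinarith
    field_simp
    -- Meridian trace 2 factors as the cubic times the companion factor p3 of the ellipticity
    -- argument.
    linear_combination (t₁ ^ 2 - (t₁ + 1) * (t₁ ^ 2 - 1)) * hend
  · refine pretzel_continuousOn ?_ ?_
    · refine (SU11.continuous_polar.comp_continuousOn
        (cα.prodMk (continuousOn_const (c := 0)))).congr ?_
      exact fun t ht => (curveRep_apply (hdom ht) (hp t ht)).1
    · refine (SU11.continuous_polar.comp_continuousOn (cβ.prodMk cR)).congr ?_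
      exact fun t ht => (curveRep_apply (hdom ht) (hp t ht)).2
  · intro t ht
    obtain ⟨hA, hB⟩ := curveRep_apply (hdom ht) (hp t ht)
    refine ⟨pretzel_isEllipticRep ?_, ⟨?_, fun hne => ?_⟩, ?_, ?_, ?_⟩
    · rw [map_mul, map_inv, map_pow, hA, hB]
      refine curve_isElliptic_meridian (hdom ht) (hp t ht) ?_
      -- The product is the cubic at t₁, which is 0, minus the cubic at t.
      have : 0 < (t₁ - t) * (t₁ ^ 2 + t₁ * t + t ^ 2 + 2 * (t₁ + t) - 1) := by
        refine mul_pos (sub_pos.2 ht.2) ?_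
        nlinarith [(hdom ht).1, (hdom ht).2.1]
      linarith
    · rintro hirr rfl
      rw [habel] at hirr
      exact pretzel_abelianRep_not_isIrreducibleRep _ hirr
    · exact SU11.isIrreducibleRep_of_polar hA hB (sin_curveAlpha_neg (hdom ht)).ne
        (curveR_pos (hdom ht) (hpp t ht hne)).ne'
    · rw [hA, tr_curve_a (hdom ht)]
    · rw [hB, tr_curve_b (hdom ht) (hp t ht)]
    · rw [map_mul, hA, hB, tr_curve_ab (hdom ht) (hp t ht)]
  · intro t ht
    obtain ⟨hA, hB⟩ := curveRep_apply (hdom ht) (hp t ht)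
    refine ⟨curveAlpha_mem (hdom ht), curveBeta_mem (hdom ht), ?_, ?_, cos_curveAlpha (hdom ht),
      tan_curveBeta, curveR_sq (hdom ht) (hp t ht)⟩
    · rw [hA, SU11.toMatrix_polar]; simp
    · rw [hB, SU11.toMatrix_polar]
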